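/- Let $P,Q$ be Borel probability measures on $\mathbb{R}^d$ whose topological supports $\Omega=\operatorname{spt}P$ and $\Omega'=\operatorname{spt}Q$ are compact. Assume that $\Omega'$ is connected and that $Q(\partial C)=0$ for every convex set $C\subset\mathbb{R}^d$. Let $\varepsilon>0$ and write $(t)_+=\max\{t,0\}$. Let $\pi_*$ be the solution of the quadratically regularized optimal transport problem $$\inf_{\pi\in\Pi(P,Q)}\int \tfrac12\|x-y\|^2\,d\pi(x,y)+\frac{\varepsilon}{2}\left\|\frac{d\pi}{d(P\otimes Q)}\right\|_{L^2(P\otimes Q)}^2,$$ where $\Pi(P,Q)$ is the set of couplings of $P$ and $Q$ and the last term is $+\infty$ if $\pi\not\ll P\otimes Q$. Let $L^2_\oplus$ be the space of pairs $(f,g)\in L^2(P)\times L^2(Q)$ with $\int f\,dP=\int g\,dQ$, with the norm $\|(f,g)\|_{L^2_\oplus}=\big(\|f\|_{L^2(P)}^2+\|g\|_{L^2(Q)}^2\big)^{1/2}$, and let $(f_*,g_*)\in L^2_\oplus$ be the potentials, i.e., $$\frac{d\pi_*}{d(P\otimes Q)}(x,y)=\frac1\varepsilon\left(f_*(x)+g_*(y)-\tfrac12\|x-y\|^2\right)_+\qquad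 P\otimes Q\text{-a.e.}$$ Such $\pi_*$ and $(f_*,g_*)$ exist, and the following holds. Let $f_0:\Omega\to\mathbb{R}$ and $g_0:\Omega'\to\mathbb{R}$ be Lipschitz continuous with $\int f_0\,dP=\int g_0\,dQ$, and let the step size $\eta$ satisfy either (i) $\eta\in(0,\varepsilon)$, or (ii) $\eta=\varepsilon$ and $\operatorname{spt}\pi_*\neq\Omega\times\Omega'$. Let $(f_n,g_n)$ be the gradient ascent iterates $$f_{n+1}(x)=f_n(x)+\eta\left(1-\frac1\varepsilon\int\left(f_n(x)+g_n(y)-\tfrac12\|x-y\|^2\right)_+dQ(y)\right),$$ $$g_{n+1}(y)=g_n(y)+\eta\left(1-\frac1\varepsilon\int\left(f_n(x)+g_n(y)-\tfrac12\|x-y\|^2\right)_+dP(x)\right)$$ for the dual objective $$\Gamma(f,g)=\int f\,dP+\int g\,dQ-\frac1{2\varepsilon}\int\left(f(x)+g(y)-\tfrac12\|x-y\|^2\right)_+^2d(P\otimes Q)(x,y).$$ Then there exist $\delta_*\in(0,1)$ and $n_0\in\mathbb{N}$ such that $$\|(f_n,g_n)-(f_*,g_*)\|_{L^2_\oplus}\le\delta_*^{\,n}\qquad\text{for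 all } n\ge n_0.$$ -/

import Mathlib

open MeasureTheory
open scoped ENNReal NNReal

noncomputable section

namespace QOT

/-- The Euclidean space `ℝ^d`. -/
abbrev Rd (d : ℕ) : Type := EuclideanSpace ℝ (Fin d)

/-- The set `Π(P, Q)` of couplings: measures on `ℝ^d × ℝ^d` with marginals `P` and `Q`
(these are probability measures as soon as `P` is one). -/
def couplings {d : ℕ} (P Q : Measure (Rd d)) : Set (Measure (Rd d × Rd d)) :=
  {π | π.map Prod.fst = P ∧ π.map Prod.snd = Q}

open Classical in
/-- The primal objective `∫ ½‖x - y‖² dπ + (ε/2) ‖dπ/d(P ⊗ Q)‖²_{L²(P ⊗ Q)}`, with values in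
`[0, ∞]`; the last term is `∞` if `π` is not absolutely continuous w.r.t. `P ⊗ Q`. -/
def primalObjective {d : ℕ} (P Q : Measure (Rd d)) (ε : ℝ) (π : Measure (Rd d × Rd d)) : ℝ≥0∞ :=
  ∫⁻ z, ENNReal.ofReal (‖z.1 - z.2‖ ^ 2 / 2) ∂π +
    if π ≪ P.prod Q then
      ENNReal.ofReal (ε / 2) * ∫⁻ z, (π.rnDeriv (P.prod Q) z) ^ 2 ∂(P.prod Q)
    else ⊤

/-- `π` is an optimal coupling for the quadratically regularized optimal transport problem. -/
def IsOptimalCoupling {d : ℕ} (P Q : Measure (Rd d)) (ε : ℝ) (π : Measure (Rd d × Rd d)) : Prop :=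
  π ∈ couplings P Q ∧ ∀ π' ∈ couplings P Q, primalObjective P Q ε π ≤ primalObjective P Q ε π'

/-- The slack `f(x) + g(y) - ½‖x - y‖²`. -/
def slack {d : ℕ} (f g : Rd d → ℝ) (x y : Rd d) : ℝ :=
  f x + g y - ‖x - y‖ ^ 2 / 2

/-- Membership in `L²_⊕`: `f ∈ L²(P)`, `g ∈ L²(Q)` and `∫ f dP = ∫ g dQ`. -/
def MemL2Oplus {d : ℕ} (P Q : Measure (Rd d)) (f g : Rd d → ℝ) : Prop :=
  MemLp f 2 P ∧ MemLp g 2 Q ∧ ∫ x, f x ∂P = ∫ y, g y ∂Q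

/-- The norm of `L²_⊕`, that is, the norm of `L²(P) × L²(Q)` as a Hilbert space product. -/
def normL2Oplus {d : ℕ} (P Q : Measure (Rd d)) (f g : Rd d → ℝ) : ℝ≥0∞ :=
  (eLpNorm f 2 P ^ 2 + eLpNorm g 2 Q ^ 2) ^ (1 / 2 : ℝ)

/-- `(f, g)` are the (normalized) potentials of `π`: they lie in `L²_⊕` and `π` has the density
`(1/ε) (f(x) + g(y) - ½‖x - y‖²)₊` with respect to `P ⊗ Q`. -/
def IsPotentials {d : ℕ} (P Q : Measure (Rd d)) (ε : ℝ) (π : Measure (Rd d × Rd d))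
    (f g : Rd d → ℝ) : Prop :=
  MemL2Oplus P Q f g ∧
    π = (P.prod Q).withDensity fun z => ENNReal.ofReal (1 / ε * max (slack f g z.1 z.2) 0)

/-- The gradient `DΓ(f, g)` of the dual objective
`Γ(f, g) = ∫ f dP + ∫ g dQ - (1/(2ε)) ∫ (f(x) + g(y) - ½‖x - y‖²)₊² d(P ⊗ Q)(x, y)`. -/
def dualGradient {d : ℕ} (P Q : Measure (Rd d)) (ε : ℝ) (u : (Rd d → ℝ) × (Rd d → ℝ)) :
    (Rd d → ℝ) × (Rd d → ℝ) :=
  (fun x => 1 - 1 / ε * ∫ y, max (slack u.1 u.2 x y) 0 ∂Q,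
   fun y => 1 - 1 / ε * ∫ x, max (slack u.1 u.2 x y) 0 ∂P)

/-- The gradient iterates `(f_{n+1}, g_{n+1}) = (f_n, g_n) + η DΓ(f_n, g_n)`. -/
def iterates {d : ℕ} (P Q : Measure (Rd d)) (ε η : ℝ) (u₀ : (Rd d → ℝ) × (Rd d → ℝ)) :
    ℕ → (Rd d → ℝ) × (Rd d → ℝ)
  | 0 => u₀
  | n + 1 => iterates P Q ε η u₀ n + η • dualGradient P Q ε (iterates P Q ε η u₀ n)

end QOT

end

/-!
Write `φ` for the positive part, `A(f, g) = f ⊕ g - c` for the slack, `τ = η / ε`, and restrict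
everything to the compact supports `X` and `Y` of `P` and `Q`, where continuous functions are
bounded and open sets have positive measure. A pair `v` is a zero of the gradient of the dual
objective iff `φ(A v) / ε` is the density of a coupling.

*Existence.* The gradient step with `τ ≤ 1` averages differences of potentials with differences of
the cost, so it preserves any modulus of continuity of the cost, and it pushes means that are too
large or too small back. Hence it leaves a compact set of continuous pairs invariant
(`gradStep_mem_boundedPairs`, `isCompact_boundedPairs`). For `τ < 1` it increases the dual
objective by a multiple of the squared residual (`dualObjective_gradStep_ge`), so that a maximizer
over the compact set is a zero of the gradient (`exists_marginal_posSlack_eq`). The Fenchel-Young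
inequality then shows that the corresponding coupling is optimal
(`isOptimalCoupling_of_posSlack`).

*Convergence.* Let `v` be a zero of the gradient, `u` another pair with equal means and slack
bounded by `B`, and `w = u - v`. Then `φ(A u) - φ(A v) = θ (w₁ ⊕ w₂)` with `0 ≤ θ ≤ 1`, where `θ`
is bounded below by the weight `ω = φ(A v) / (φ(A v) + B)`, and above by `1 - σ` with `σ > 0`
where `A v < 0`. One step maps `w` to `w - τ M w` with the symmetric operator `M w = (∫ θ (w₁ ⊕
w₂) dQ, ∫ θ (w₁ ⊕ w₂) dP)`, which is a contraction as soon as `M` is bounded below by a positive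
constant and `τ M` above by a constant less than `2`.

* Lower bound: `∫∫ ω (w₁ ⊕ w₂)²` controls the squared norm of `w`
  (`exists_integral_sq_add_integral_sq_le`). The set `{ω > 0}` is open and meets every section, so
  that a small energy makes `w₂` nearly constant locally, thus globally because `Y` is connected,
  and `w₁` nearly the opposite constant; equality of the means makes the constant nearly `0`.
* Upper bound: `M ≤ 2` suffices for `τ < 1`. For `τ = 1` the norm `2` would be attained at
  constants only, and these are excluded when `A v` is negative somewhere
  (`integral_one_sub_mul_sq_le`).

Since iterates stay bounded, the contraction factor is uniform and no preliminary convergence is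
needed (`exists_sqNorm_gradStep_sub_le`, `exists_abs_slack_iterate_le`). The same gap shows that
square-integrable potentials agree almost everywhere with `v` (`IsPotentials.ae_eq`).

*Negativity of the slack.* If `A v ≥ 0` everywhere, then `φ` disappears from the gradient
equation, `A v (x, ·)` is affine for every `x`, and its zero set is `Q`-null as the boundary of a
convex set. Then the optimal coupling and `P ⊗ Q` are mutually absolutely continuous and have the
same support (`exists_slack_neg`).
-/

namespace QOT

open Filter Set
open scoped Topology

set_option linter.unusedSectionVars false

/-! ### Spectral gap of the energy -/

lemma enorm_sq_eq_ofReal (a : ℝ) : ‖a‖ₑ ^ 2 = ENNReal.ofReal (a ^ 2) := by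
  rw [← ofReal_norm, ← ENNReal.ofReal_pow (norm_nonneg _), Real.norm_eq_abs, sq_abs]

lemma enorm_add_sq_le (a b : ℝ) : ‖a + b‖ₑ ^ 2 ≤ 2 * ‖a‖ₑ ^ 2 + 2 * ‖b‖ₑ ^ 2 := by
  simp only [enorm_sq_eq_ofReal]
  rw [show (2 : ℝ≥0∞) = ENNReal.ofReal 2 by simp, ← ENNReal.ofReal_mul (by norm_num),
    ← ENNReal.ofReal_mul (by norm_num), ← ENNReal.ofReal_add (by positivity) (by positivity)]
  exact ENNReal.ofReal_le_ofReal (by nlinarith [sq_nonneg (a - b)])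

lemma _root_.MeasureTheory.MemLp.integrable_add_const_sq {α : Type*} [MeasurableSpace α]
    {μ : Measure α} [IsFiniteMeasure μ] {h : α → ℝ} (hh : MemLp h 2 μ) (b : ℝ) :
    Integrable (fun x => (h x + b) ^ 2) μ :=
  (hh.add (memLp_const b)).integrable_sq

lemma _root_.MeasureTheory.MemLp.integral_add_const_sq {α : Type*} [MeasurableSpace α]
    {μ : Measure α} [IsProbabilityMeasure μ] {h : α → ℝ} (hh : MemLp h 2 μ) (b : ℝ) :
    ∫ x, (h x + b) ^ 2 ∂μ = ∫ x, h x ^ 2 ∂μ + 2 * b * ∫ x, h x ∂μ + b ^ 2 := by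
  have h1 : Integrable (fun x => 2 * b * h x) μ := (hh.integrable one_le_two).const_mul _
  have h2 : Integrable (fun x => h x ^ 2) μ := hh.integrable_sq
  have h12 : Integrable (fun x => h x ^ 2 + 2 * b * h x) μ := h2.add h1
  have : ∀ x, (h x + b) ^ 2 = h x ^ 2 + 2 * b * h x + b ^ 2 := fun x => by ring
  simp only [this]
  rw [integral_add h12 (integrable_const _), integral_add h2 h1, integral_const_mul]
  simp

section Gap

variable {X Y : Type*} [TopologicalSpace X] [MeasurableSpace X] [BorelSpace X]
  [TopologicalSpace Y] [MeasurableSpace Y] [BorelSpace Y]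

/-- The energy `∫∫ ω(x, y) (h(x) + k(y))² dQ(y) dP(x)` of a pair `(h, k)` for a weight `ω`, with
values in `[0, ∞]`. -/
noncomputable def weightedEnergy (P : Measure X) (Q : Measure Y) (ω : X × Y → ℝ) (h : X → ℝ)
    (k : Y → ℝ) : ℝ≥0∞ :=
  ∫⁻ x, ∫⁻ y, ENNReal.ofReal (ω (x, y)) * ‖h x + k y‖ₑ ^ 2 ∂Q ∂P

/-- Near a point where the weight is positive, the energy controls `h ⊕ k` on a rectangle. -/
lemma exists_rectangle_lintegral_le (P : Measure X) (Q : Measure Y) {ω : X × Y → ℝ}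
    (hω : Continuous ω) {x₀ : X} {y₀ : Y} (h₀ : 0 < ω (x₀, y₀)) :
    ∃ (U : Set X) (V : Set Y) (C : ℝ≥0∞), IsOpen U ∧ IsOpen V ∧ x₀ ∈ U ∧ y₀ ∈ V ∧ C ≠ ∞ ∧
      ∀ h k, ∫⁻ x in U, ∫⁻ y in V, ‖h x + k y‖ₑ ^ 2 ∂Q ∂P ≤ C * weightedEnergy P Q ω h k := by
  have hopen : IsOpen {z | ω (x₀, y₀) / 2 < ω z} := isOpen_lt continuous_const hω
  obtain ⟨U, V, hU, hV, hxU, hyV, hUV⟩ := isOpen_prod_iff.1 hopen x₀ y₀ (by simpa using h₀)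
  have hκ : ENNReal.ofReal (ω (x₀, y₀) / 2) ≠ 0 := by simpa using h₀
  refine ⟨U, V, (ENNReal.ofReal (ω (x₀, y₀) / 2))⁻¹, hU, hV, hxU, hyV, by simpa using h₀, ?_⟩
  intro h k
  have hC : (ENNReal.ofReal (ω (x₀, y₀) / 2))⁻¹ ≠ ∞ := by simpa using h₀
  rw [weightedEnergy, ← lintegral_const_mul' _ _ hC]
  refine (setLIntegral_mono' hU.measurableSet fun x hx => ?_).trans (setLIntegral_le_lintegral _ _)
  rw [← lintegral_const_mul' _ _ hC]
  refine (setLIntegral_mono' hV.measurableSet fun y hy => ?_).trans (setLIntegral_le_lintegral _ _)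
  rw [← mul_assoc]
  refine le_mul_of_one_le_left zero_le ?_
  rw [← ENNReal.inv_mul_cancel hκ ENNReal.ofReal_ne_top]
  gcongr
  exact le_of_lt (hUV (Set.mk_mem_prod hx hy))

/-- Local form of the spectral gap: freezing `x` at a point where the inner integral is at most
average shows that `k` is close to the constant `-h x` near `y₀`. -/
lemma exists_nhds_lintegral_sub_const_le (P : Measure X) (Q : Measure Y) [IsProbabilityMeasure P]
    [P.IsOpenPosMeasure] [IsProbabilityMeasure Q] {ω : X × Y → ℝ}
    (hω : Continuous ω) {x₀ : X} {y₀ : Y} (h₀ : 0 < ω (x₀, y₀)) :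
    ∃ (V : Set Y) (C : ℝ≥0∞), IsOpen V ∧ y₀ ∈ V ∧ C ≠ ∞ ∧
      ∀ h k, Measurable h → Measurable k →
        ∃ b : ℝ, ∫⁻ y in V, ‖k y - b‖ₑ ^ 2 ∂Q ≤ C * weightedEnergy P Q ω h k := by
  obtain ⟨U, V, C, hU, hV, hxU, hyV, hC, hle⟩ := exists_rectangle_lintegral_le P Q hω h₀
  have hPU : P U ≠ 0 := (hU.measure_pos P ⟨x₀, hxU⟩).ne'
  refine ⟨V, (P U)⁻¹ * C, hV, hyV, ENNReal.mul_ne_top (by simpa using hPU) hC, ?_⟩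
  intro h k hh hk
  have hm : Measurable fun x => ∫⁻ y in V, ‖h x + k y‖ₑ ^ 2 ∂Q :=
    Measurable.lintegral_prod_right' (f := fun z : X × Y => ‖h z.1 + k z.2‖ₑ ^ 2) (by fun_prop)
  obtain ⟨x, -, hx⟩ := exists_le_setLAverage hPU (measure_ne_top P U) hm.aemeasurable
  refine ⟨-h x, ?_⟩
  have : ∀ y, k y - -h x = h x + k y := fun y => by ring
  simp only [this]
  refine hx.trans ?_
  rw [setLAverage_eq, mul_assoc, ENNReal.div_eq_inv_mul]
  gcongr
  exact hle h k

/-- A function that is close to two constants on a set of positive measure forces the constants to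
be close to one another. -/
lemma enorm_sub_sq_mul_measure_le (Q : Measure Y) (k : Y → ℝ) (hk : Measurable k) (b b' : ℝ)
    (W : Set Y) :
    ‖b - b'‖ₑ ^ 2 * Q W ≤
      2 * ∫⁻ y in W, ‖k y - b‖ₑ ^ 2 ∂Q + 2 * ∫⁻ y in W, ‖k y - b'‖ₑ ^ 2 ∂Q := by
  rw [← setLIntegral_const, ← lintegral_const_mul _ (by fun_prop),
    ← lintegral_const_mul _ (by fun_prop), ← lintegral_add_left (by fun_prop)]
  refine lintegral_mono fun y => ?_
  have := enorm_add_sq_le (-(k y - b)) (k y - b')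
  rwa [enorm_neg, show -(k y - b) + (k y - b') = b - b' by ring] at this

/-- **Spectral gap**, second potential: if `Y` is connected, the energy controls the distance of
`k` to some constant. The points of `Y` near which `k` is controlled by a fixed constant form a
clopen set. -/
lemma exists_lintegral_snd_sub_const_le (P : Measure X) (Q : Measure Y) [IsProbabilityMeasure P]
    [P.IsOpenPosMeasure] [IsProbabilityMeasure Q] [Q.IsOpenPosMeasure] [CompactSpace Y]
    [ConnectedSpace Y] {ω : X × Y → ℝ} (hω : Continuous ω) (hpos : ∀ y, ∃ x, 0 < ω (x, y)) :
    ∃ (b : (X → ℝ) → (Y → ℝ) → ℝ) (C : ℝ≥0∞), C ≠ ∞ ∧ ∀ h k, Measurable h → Measurable k →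
      ∫⁻ y, ‖k y - b h k‖ₑ ^ 2 ∂Q ≤ C * weightedEnergy P Q ω h k := by
  have hloc : ∀ y₀ : Y, ∃ (V : Set Y) (C : ℝ≥0∞), IsOpen V ∧ y₀ ∈ V ∧ C ≠ ∞ ∧
      ∀ h k, Measurable h → Measurable k →
        ∃ b : ℝ, ∫⁻ y in V, ‖k y - b‖ₑ ^ 2 ∂Q ≤ C * weightedEnergy P Q ω h k := fun y₀ =>
    let ⟨_, hx⟩ := hpos y₀
    exists_nhds_lintegral_sub_const_le P Q hω hx
  obtain ⟨y₀⟩ : Nonempty Y := inferInstance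
  obtain ⟨V₀, C₀, hV₀, hy₀, hC₀, hb₀⟩ := hloc y₀
  choose! b hb using hb₀
  let S : Set Y := {y | ∃ (V : Set Y) (C : ℝ≥0∞), IsOpen V ∧ y ∈ V ∧ C ≠ ∞ ∧
    ∀ h k, Measurable h → Measurable k →
      ∫⁻ y in V, ‖k y - b h k‖ₑ ^ 2 ∂Q ≤ C * weightedEnergy P Q ω h k}
  have hSopen : IsOpen S := by
    refine isOpen_iff_mem_nhds.2 fun y ⟨V, C, hV, hy, hC, h⟩ => ?_
    exact Filter.mem_of_superset (hV.mem_nhds hy) fun y' hy' => ⟨V, C, hV, hy', hC, h⟩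
  have hSclosed : IsClosed S := by
    refine isClosed_of_closure_subset fun y hy => ?_
    obtain ⟨W, C, hW, hyW, hC, hWb⟩ := hloc y
    obtain ⟨y₁, hy₁W, V₁, C₁, hV₁, hy₁V, hC₁, hV₁b⟩ := mem_closure_iff.1 hy W hW hyW
    have hQ : Q (W ∩ V₁) ≠ 0 := ((hW.inter hV₁).measure_pos Q ⟨y₁, hy₁W, hy₁V⟩).ne'
    refine ⟨W, 2 * C + 2 * ((Q (W ∩ V₁))⁻¹ * (2 * C + 2 * C₁)), hW, hyW, by finiteness, ?_⟩
    intro h k hh hk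
    obtain ⟨b', hb'⟩ := hWb h k hh hk
    have h1 : ‖b' - b h k‖ₑ ^ 2 ≤
        (Q (W ∩ V₁))⁻¹ * (2 * C + 2 * C₁) * weightedEnergy P Q ω h k := by
      have hle := enorm_sub_sq_mul_measure_le Q k hk b' (b h k) (W ∩ V₁)
      rw [mul_assoc, ← ENNReal.div_eq_inv_mul,
        ENNReal.le_div_iff_mul_le (.inl hQ) (.inl (by finiteness))]
      refine hle.trans ?_
      rw [add_mul, mul_assoc, mul_assoc]
      gcongr
      · exact (lintegral_mono_set inter_subset_left).trans hb'
      · exact (lintegral_mono_set inter_subset_right).trans (hV₁b h k hh hk)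
    calc ∫⁻ y in W, ‖k y - b h k‖ₑ ^ 2 ∂Q
        ≤ ∫⁻ y in W, (2 * ‖k y - b'‖ₑ ^ 2 + 2 * ‖b' - b h k‖ₑ ^ 2) ∂Q := by
          refine lintegral_mono fun y => ?_
          have := enorm_add_sq_le (k y - b') (b' - b h k)
          rwa [sub_add_sub_cancel] at this
      _ = 2 * ∫⁻ y in W, ‖k y - b'‖ₑ ^ 2 ∂Q + 2 * ‖b' - b h k‖ₑ ^ 2 * Q W := by
          rw [lintegral_add_left (by fun_prop), lintegral_const_mul _ (by fun_prop),
            setLIntegral_const]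
      _ ≤ 2 * (C * weightedEnergy P Q ω h k) + 2 * ((Q (W ∩ V₁))⁻¹ * (2 * C + 2 * C₁) *
            weightedEnergy P Q ω h k) * 1 := by
          gcongr
          exact prob_le_one
      _ = _ := by ring
  have hSuniv : S = univ := IsClopen.eq_univ ⟨hSclosed, hSopen⟩ ⟨y₀, V₀, C₀, hV₀, hy₀, hC₀, hb⟩
  refine ⟨b, ?_⟩
  have key := isCompact_univ.induction_on (p := fun s : Set Y => ∃ C : ℝ≥0∞, C ≠ ∞ ∧
    ∀ h k, Measurable h → Measurable k →
      ∫⁻ y in s, ‖k y - b h k‖ₑ ^ 2 ∂Q ≤ C * weightedEnergy P Q ω h k)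
    ⟨0, by simp, by simp⟩
    (fun s t hst ⟨C, hC, h⟩ => ⟨C, hC, fun f g hf hg =>
      (lintegral_mono_set hst).trans (h f g hf hg)⟩)
    (fun s t ⟨C, hC, h⟩ ⟨C', hC', h'⟩ => ⟨C + C', by finiteness, fun f g hf hg => by
      rw [add_mul]
      exact (lintegral_union_le _ _ _).trans (add_le_add (h f g hf hg) (h' f g hf hg))⟩)
    (fun y _ => by
      obtain ⟨V, C, hV, hy, hC, h⟩ : y ∈ S := hSuniv ▸ mem_univ y
      exact ⟨V, mem_nhdsWithin_of_mem_nhds (hV.mem_nhds hy), C, hC, h⟩)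
  simpa using key

/-- **Spectral gap** in `[0, ∞]`: the energy controls the distance of `(h, k)` to the kernel
`{(-b, b) | b ∈ ℝ}` of `(h, k) ↦ h ⊕ k`. -/
lemma exists_lintegral_sub_const_add_le (P : Measure X) (Q : Measure Y) [IsProbabilityMeasure P]
    [P.IsOpenPosMeasure] [IsProbabilityMeasure Q] [Q.IsOpenPosMeasure] [CompactSpace X]
    [CompactSpace Y] [ConnectedSpace Y] {ω : X × Y → ℝ} (hω : Continuous ω)
    (hposY : ∀ y, ∃ x, 0 < ω (x, y)) (hposX : ∀ x, ∃ y, 0 < ω (x, y)) :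
    ∃ C : ℝ≥0∞, C ≠ ∞ ∧ ∀ h k, Measurable h → Measurable k → ∃ b : ℝ,
      ∫⁻ x, ‖h x + b‖ₑ ^ 2 ∂P + ∫⁻ y, ‖k y - b‖ₑ ^ 2 ∂Q ≤ C * weightedEnergy P Q ω h k := by
  obtain ⟨b, C, hC, hb⟩ := exists_lintegral_snd_sub_const_le P Q hω hposY
  have key := isCompact_univ.induction_on (p := fun s : Set X => ∃ C : ℝ≥0∞, C ≠ ∞ ∧
    ∀ h k, Measurable h → Measurable k →
      ∫⁻ x in s, ‖h x + b h k‖ₑ ^ 2 ∂P ≤ C * weightedEnergy P Q ω h k)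
    ⟨0, by simp, by simp⟩
    (fun s t hst ⟨C, hC, h⟩ => ⟨C, hC, fun f g hf hg =>
      (lintegral_mono_set hst).trans (h f g hf hg)⟩)
    (fun s t ⟨C, hC, h⟩ ⟨C', hC', h'⟩ => ⟨C + C', by finiteness, fun f g hf hg => by
      rw [add_mul]
      exact (lintegral_union_le _ _ _).trans (add_le_add (h f g hf hg) (h' f g hf hg))⟩)
    (fun x _ => by
      obtain ⟨y, hy⟩ := hposX x
      obtain ⟨U, V, C', hU, hV, hxU, hyV, hC', hle⟩ := exists_rectangle_lintegral_le P Q hω hy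
      have hQV : Q V ≠ 0 := (hV.measure_pos Q ⟨y, hyV⟩).ne'
      refine ⟨U, mem_nhdsWithin_of_mem_nhds (hU.mem_nhds hxU), (Q V)⁻¹ * (2 * C' + 2 * C),
        by finiteness, fun h k hh hk => ?_⟩
      rw [mul_assoc, ← ENNReal.div_eq_inv_mul,
        ENNReal.le_div_iff_mul_le (.inl hQV) (.inl (by finiteness)),
        ← lintegral_mul_const _ (by fun_prop)]
      have hm : Measurable fun x => ∫⁻ y in V, ‖h x + k y‖ₑ ^ 2 ∂Q :=
        Measurable.lintegral_prod_right' (f := fun z : X × Y => ‖h z.1 + k z.2‖ₑ ^ 2)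
          (by fun_prop)
      calc ∫⁻ x in U, ‖h x + b h k‖ₑ ^ 2 * Q V ∂P
          ≤ ∫⁻ x in U, (2 * ∫⁻ y in V, ‖h x + k y‖ₑ ^ 2 ∂Q +
              2 * ∫⁻ y, ‖k y - b h k‖ₑ ^ 2 ∂Q) ∂P := by
            refine lintegral_mono fun x => ?_
            have := enorm_sub_sq_mul_measure_le Q k hk (-h x) (b h k) V
            rw [show -h x - b h k = -(h x + b h k) by ring, enorm_neg] at this
            refine this.trans ?_
            gcongr ?_ + ?_
            · simp only [sub_neg_eq_add, add_comm, le_refl]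
            · gcongr
              exact Measure.restrict_le_self
        _ = 2 * ∫⁻ x in U, ∫⁻ y in V, ‖h x + k y‖ₑ ^ 2 ∂Q ∂P +
              2 * (∫⁻ y, ‖k y - b h k‖ₑ ^ 2 ∂Q) * P U := by
            rw [lintegral_add_right _ measurable_const, lintegral_const_mul _ hm,
              setLIntegral_const]
        _ ≤ 2 * (C' * weightedEnergy P Q ω h k) + 2 * (C * weightedEnergy P Q ω h k) * 1 := by
            gcongr
            · exact hle h k
            · exact hb h k hh hk
            · exact prob_le_one
        _ = _ := by ring)
  obtain ⟨C', hC', hb'⟩ := key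
  simp only [Measure.restrict_univ] at hb'
  refine ⟨C' + C, by finiteness, fun h k hh hk => ⟨b h k, ?_⟩⟩
  rw [add_mul]
  exact add_le_add (hb' h k hh hk) (hb h k hh hk)

/-- **Spectral gap**: on pairs `(h, k)` with equal means, the energy `∫∫ ω (h ⊕ k)²` dominates the
squared norm. -/
theorem exists_integral_sq_add_integral_sq_le (P : Measure X) (Q : Measure Y)
    [SecondCountableTopologyEither X Y]
    [IsProbabilityMeasure P]
    [P.IsOpenPosMeasure] [IsProbabilityMeasure Q] [Q.IsOpenPosMeasure] [CompactSpace X]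
    [CompactSpace Y] [ConnectedSpace Y] {ω : X × Y → ℝ} (hω : Continuous ω) (hω0 : ∀ z, 0 ≤ ω z)
    (hposY : ∀ y, ∃ x, 0 < ω (x, y)) (hposX : ∀ x, ∃ y, 0 < ω (x, y)) :
    ∃ C : ℝ, 0 < C ∧ ∀ h k, MemLp h 2 P → MemLp k 2 Q → ∫ x, h x ∂P = ∫ y, k y ∂Q →
      ∫ x, h x ^ 2 ∂P + ∫ y, k y ^ 2 ∂Q ≤
        C * ∫ z, ω z * (h z.1 + k z.2) ^ 2 ∂(P.prod Q) := by
  obtain ⟨C, hC, hgap⟩ := exists_lintegral_sub_const_add_le P Q hω hposY hposX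
  obtain ⟨M, hM⟩ : ∃ M, ∀ z, ‖ω z‖ ≤ M := by
    obtain ⟨M, hM⟩ := isCompact_univ.exists_bound_of_continuousOn hω.continuousOn
    exact ⟨M, fun z => hM z (mem_univ z)⟩
  refine ⟨C.toReal + 1, by positivity, fun h k hh hk hmean => ?_⟩
  have hint : Integrable (fun z : X × Y => ω z * (h z.1 + k z.2) ^ 2) (P.prod Q) := by
    refine Integrable.bdd_mul (c := M) ?_ hω.measurable.aestronglyMeasurable (.of_forall hM)
    have : MemLp (fun z : X × Y => h z.1 + k z.2) 2 (P.prod Q) :=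
      (hh.comp_fst Q).add (hk.comp_snd P)
    exact this.integrable_sq
  have hint0 : 0 ≤ ∫ z, ω z * (h z.1 + k z.2) ^ 2 ∂(P.prod Q) :=
    integral_nonneg fun z => mul_nonneg (hω0 z) (sq_nonneg _)
  refine le_trans ?_ (mul_le_mul_of_nonneg_right (le_add_of_nonneg_right zero_le_one) hint0)
  have hE : ∀ h' k', Measurable h' → Measurable k' → h =ᵐ[P] h' → k =ᵐ[Q] k' →
      weightedEnergy P Q ω h' k' =
        ENNReal.ofReal (∫ z, ω z * (h z.1 + k z.2) ^ 2 ∂(P.prod Q)) := by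
    intro h' k' hh' hk' hhe hke
    rw [ofReal_integral_eq_lintegral_ofReal hint
      (.of_forall fun z => mul_nonneg (hω0 z) (sq_nonneg _)), weightedEnergy,
      ← lintegral_prod (fun z : X × Y => ENNReal.ofReal (ω z) * ‖h' z.1 + k' z.2‖ₑ ^ 2)
        (by have := hω.measurable; fun_prop)]
    refine lintegral_congr_ae ?_
    filter_upwards [Measure.quasiMeasurePreserving_fst.ae_eq_comp hhe,
      Measure.quasiMeasurePreserving_snd.ae_eq_comp hke] with z h1 h2
    simp only [Function.comp_apply] at h1 h2
    rw [← h1, ← h2, enorm_sq_eq_ofReal, ENNReal.ofReal_mul (hω0 z)]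
  obtain ⟨b, hb⟩ := hgap _ _ hh.1.measurable_mk hk.1.measurable_mk
  rw [hE _ _ hh.1.measurable_mk hk.1.measurable_mk hh.1.ae_eq_mk hk.1.ae_eq_mk] at hb
  have e1 : ∫⁻ x, ‖hh.1.mk h x + b‖ₑ ^ 2 ∂P = ENNReal.ofReal (∫ x, (h x + b) ^ 2 ∂P) := by
    rw [ofReal_integral_eq_lintegral_ofReal (hh.integrable_add_const_sq b)
      (.of_forall fun z => sq_nonneg _)]
    refine lintegral_congr_ae ?_
    filter_upwards [hh.1.ae_eq_mk] with x hx
    rw [← hx, enorm_sq_eq_ofReal]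
  have e2 : ∫⁻ y, ‖hk.1.mk k y - b‖ₑ ^ 2 ∂Q = ENNReal.ofReal (∫ y, (k y + -b) ^ 2 ∂Q) := by
    rw [ofReal_integral_eq_lintegral_ofReal (hk.integrable_add_const_sq (-b))
      (.of_forall fun z => sq_nonneg _)]
    refine lintegral_congr_ae ?_
    filter_upwards [hk.1.ae_eq_mk] with x hx
    rw [← hx, enorm_sq_eq_ofReal, sub_eq_add_neg]
  rw [e1, e2, ← ENNReal.ofReal_add (integral_nonneg fun _ => sq_nonneg _)
    (integral_nonneg fun _ => sq_nonneg _), ← ENNReal.ofReal_toReal hC,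
    ← ENNReal.ofReal_mul ENNReal.toReal_nonneg,
    ENNReal.ofReal_le_ofReal_iff (by positivity)] at hb
  rw [hh.integral_add_const_sq, hk.integral_add_const_sq, hmean] at hb
  nlinarith [sq_nonneg b]

end Gap

/-! ### The gradient step as a contraction -/

section PosPart

lemma posPart_sub_mul_sub_nonneg (s t : ℝ) : 0 ≤ (max s 0 - max t 0) * (s - t) := by
  rcases le_total s t with h | h
  · exact mul_nonneg_of_nonpos_of_nonpos (sub_nonpos.2 (max_le_max_right 0 h)) (sub_nonpos.2 h)
  · exact mul_nonneg (sub_nonneg.2 (max_le_max_right 0 h)) (sub_nonneg.2 h)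

/-- The difference quotient of the positive part at `t > 0` and `s ∈ [-B, B]` is at least
`t / (t + B)`. -/
lemma weight_mul_sq_le {s t B : ℝ} (hB : 0 < B) (hs : |s| ≤ B) :
    max t 0 / (max t 0 + B) * (s - t) ^ 2 ≤ (max s 0 - max t 0) * (s - t) := by
  have hs' := abs_le.1 hs
  rcases le_or_gt t 0 with ht | ht
  · rw [max_eq_right ht]
    have := posPart_sub_mul_sub_nonneg s t
    rw [max_eq_right ht] at this
    simpa using this
  · rw [max_eq_left ht.le, div_mul_eq_mul_div, div_le_iff₀ (by positivity)]
    rcases le_total 0 s with h | h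
    · rw [max_eq_left h]
      nlinarith [mul_nonneg hB.le (sq_nonneg (s - t))]
    · rw [max_eq_right h]
      have : 0 ≤ t * (t - s) := mul_nonneg ht.le (by linarith)
      nlinarith

/-- The difference quotient of the positive part at `t < 0` and `s ∈ [-B, B]` is at most
`1 - |t| / (|t| + B)`. -/
lemma exists_posPart_sub_eq_mul {s t B : ℝ} (hB : 0 < B) (hs : |s| ≤ B) :
    ∃ θ : ℝ, 0 ≤ θ ∧ θ ≤ 1 - max (-t) 0 / (max (-t) 0 + B) ∧
      max s 0 - max t 0 = θ * (s - t) := by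
  have hs' := abs_le.1 hs
  rcases eq_or_ne s t with rfl | hne
  · refine ⟨0, le_rfl, ?_, by simp⟩
    rw [sub_nonneg, div_le_one (by positivity)]
    linarith
  have hne' : s - t ≠ 0 := sub_ne_zero.2 hne
  refine ⟨(max s 0 - max t 0) / (s - t), ?_, ?_, by field_simp⟩
  · have := posPart_sub_mul_sub_nonneg s t
    rw [← mul_div_mul_right _ _ hne']
    exact div_nonneg this (mul_self_nonneg _)
  · rcases le_or_gt 0 t with ht | ht
    · rw [max_eq_left ht, max_eq_right (neg_nonpos.2 ht)]
      simp only [zero_div, sub_zero, zero_add]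
      rcases lt_or_gt_of_ne hne' with h | h
      · rw [div_le_one_of_neg h]
        linarith [le_max_left s 0]
      · rw [div_le_one h]
        rw [max_eq_left (by linarith)]
    · rw [max_eq_right ht.le, max_eq_left (by linarith : (0 : ℝ) ≤ -t), sub_zero]
      rw [show 1 - -t / (-t + B) = B / (-t + B) by field_simp [(by linarith : -t + B ≠ 0)]; ring]
      rcases le_total s 0 with h | h
      · rw [max_eq_right h, zero_div]
        exact div_nonneg hB.le (by linarith)
      · rw [max_eq_left h, div_le_div_iff₀ (by linarith) (by linarith)]
        nlinarith

/-- A weighted Young inequality for increments of the positive part. -/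
lemma posPart_sub_mul_le {s t B κ : ℝ} (hB : 0 < B) (hs : |s| ≤ B) (hκ : 0 < κ) (b : ℝ) :
    (max s 0 - max t 0) * b ≤ κ / 2 * ((max s 0 - max t 0) * (s - t)) +
      1 / (2 * κ) * ((1 - max (-t) 0 / (max (-t) 0 + B)) * b ^ 2) := by
  obtain ⟨θ, h0, h1, h2⟩ := exists_posPart_sub_eq_mul (t := t) hB hs
  rw [h2]
  have h3 : θ * b ^ 2 ≤ (1 - max (-t) 0 / (max (-t) 0 + B)) * b ^ 2 :=
    mul_le_mul_of_nonneg_right h1 (sq_nonneg b)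
  have h4 : 0 ≤ 1 / (2 * κ) * (θ * (κ * (s - t) - b) ^ 2) := by positivity
  have h5 : 1 / (2 * κ) * (θ * (κ * (s - t) - b) ^ 2) =
      κ / 2 * (θ * (s - t) * (s - t)) + 1 / (2 * κ) * (θ * b ^ 2) - θ * (s - t) * b := by
    field_simp
    ring
  have h6 : 1 / (2 * κ) * (θ * b ^ 2) ≤
      1 / (2 * κ) * ((1 - max (-t) 0 / (max (-t) 0 + B)) * b ^ 2) :=
    mul_le_mul_of_nonneg_left h3 (by positivity)
  linarith

end PosPart

section Operators

variable {X Y : Type*} [TopologicalSpace X] [MeasurableSpace X] [BorelSpace X] [CompactSpace X]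
  [SecondCountableTopology X]
  [TopologicalSpace Y] [MeasurableSpace Y] [BorelSpace Y] [CompactSpace Y]
  [SecondCountableTopology Y]

lemma _root_.Continuous.integrable_of_compactSpace {μ : Measure X}
    [IsFiniteMeasure μ] {F : X → ℝ}
    (hF : Continuous F) : Integrable F μ :=
  hF.integrable_of_hasCompactSupport (HasCompactSupport.of_compactSpace F)

lemma _root_.Continuous.memLp_of_compactSpace {μ : Measure X}
    [IsFiniteMeasure μ] {F : X → ℝ}
    (hF : Continuous F) (p : ℝ≥0∞) : MemLp F p μ :=
  hF.memLp_of_hasCompactSupport (HasCompactSupport.of_compactSpace F)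

/-- The function `x ↦ ∫ F(x, y) dQ(y)`. -/
noncomputable def fstMarginal (Q : Measure Y) [IsFiniteMeasure Q] (F : C(X × Y, ℝ)) : C(X, ℝ) where
  toFun x := ∫ y, F (x, y) ∂Q
  continuous_toFun := by
    obtain ⟨M, hM⟩ := isCompact_univ.exists_bound_of_continuousOn F.continuous.continuousOn
    refine continuous_of_dominated (bound := fun _ => M) (fun x => ?_)
      (fun x => .of_forall fun y => hM _ (mem_univ _)) (integrable_const M)
      (.of_forall fun y => by fun_prop)
    exact Continuous.aestronglyMeasurable (by fun_prop)

/-- The function `y ↦ ∫ F(x, y) dP(x)`. -/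
noncomputable def sndMarginal (P : Measure X) [IsFiniteMeasure P] (F : C(X × Y, ℝ)) : C(Y, ℝ) :=
  fstMarginal P (F.comp ContinuousMap.prodSwap)

/-- The positive part `(f(x) + g(y) - c(x, y))₊` of the slack, for a continuous cost `c`. -/
def posSlack (c : C(X × Y, ℝ)) (u : C(X, ℝ) × C(Y, ℝ)) : C(X × Y, ℝ) where
  toFun z := max (u.1 z.1 + u.2 z.2 - c z) 0

/-- The gradient step with step size `η = τ ε`. -/
noncomputable def gradStep (P : Measure X) (Q : Measure Y) [IsFiniteMeasure P] [IsFiniteMeasure Q]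
    (c : C(X × Y, ℝ)) (ε τ : ℝ) (u : C(X, ℝ) × C(Y, ℝ)) : C(X, ℝ) × C(Y, ℝ) :=
  (u.1 + τ • (ContinuousMap.const X ε - fstMarginal Q (posSlack c u)),
   u.2 + τ • (ContinuousMap.const Y ε - sndMarginal P (posSlack c u)))

@[simp] lemma fstMarginal_apply (Q : Measure Y) [IsFiniteMeasure Q] (F : C(X × Y, ℝ)) (x : X) :
    fstMarginal Q F x = ∫ y, F (x, y) ∂Q := rfl

@[simp] lemma sndMarginal_apply (P : Measure X) [IsFiniteMeasure P] (F : C(X × Y, ℝ)) (y : Y) :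
    sndMarginal P F y = ∫ x, F (x, y) ∂P := rfl

@[simp] lemma posSlack_apply (c : C(X × Y, ℝ)) (u : C(X, ℝ) × C(Y, ℝ)) (z : X × Y) :
    posSlack c u z = max (u.1 z.1 + u.2 z.2 - c z) 0 := rfl

variable (P : Measure X) (Q : Measure Y)
  [IsProbabilityMeasure P] [IsProbabilityMeasure Q]

/-- The marginals are adjoint to `(a, b) ↦ a ⊕ b`. -/
lemma integral_mul_add (F : C(X × Y, ℝ)) (a : C(X, ℝ)) (b : C(Y, ℝ)) :
    ∫ z, F z * (a z.1 + b z.2) ∂(P.prod Q) =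
      ∫ x, a x * fstMarginal Q F x ∂P + ∫ y, b y * sndMarginal P F y ∂Q := by
  have h1 : Integrable (fun z : X × Y => a z.1 * F z) (P.prod Q) :=
    Continuous.integrable_of_compactSpace (by fun_prop)
  have h2 : Integrable (fun z : X × Y => b z.2 * F z) (P.prod Q) :=
    Continuous.integrable_of_compactSpace (by fun_prop)
  have h3 : ∀ z : X × Y, F z * (a z.1 + b z.2) = a z.1 * F z + b z.2 * F z := fun z => by ring
  simp only [h3]
  rw [integral_add h1 h2, integral_prod _ h1, integral_prod_symm _ h2]
  simp [integral_const_mul]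

lemma integral_fstMarginal (F : C(X × Y, ℝ)) :
    ∫ x, fstMarginal Q F x ∂P = ∫ z, F z ∂(P.prod Q) := by
  have := integral_mul_add P Q F 1 0
  simpa using this.symm

lemma integral_sndMarginal (F : C(X × Y, ℝ)) :
    ∫ y, sndMarginal P F y ∂Q = ∫ z, F z ∂(P.prod Q) := by
  have := integral_mul_add P Q F 0 1
  simpa using this.symm

lemma sq_integral_le_integral_sq (a : C(X, ℝ)) : (∫ x, a x ∂P) ^ 2 ≤ ∫ x, a x ^ 2 ∂P := by
  have h := (a.continuous.memLp_of_compactSpace (μ := P) 2).integral_add_const_sq (-∫ x, a x ∂P)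
  have h' : 0 ≤ ∫ x, (a x + -∫ x, a x ∂P) ^ 2 ∂P := integral_nonneg fun _ => sq_nonneg _
  nlinarith

/-- `∫ a² dP + ∫ b² dQ`, the squared norm of `L²(P) × L²(Q)`. -/
noncomputable def sqNorm (a : X → ℝ) (b : Y → ℝ) : ℝ := ∫ x, a x ^ 2 ∂P + ∫ y, b y ^ 2 ∂Q

lemma sqNorm_nonneg (a : X → ℝ) (b : Y → ℝ) : 0 ≤ sqNorm P Q a b :=
  add_nonneg (integral_nonneg fun _ => sq_nonneg _) (integral_nonneg fun _ => sq_nonneg _)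

lemma integral_add_sq (a : C(X, ℝ)) (b : C(Y, ℝ)) :
    ∫ z, (a z.1 + b z.2) ^ 2 ∂(P.prod Q) =
      sqNorm P Q a b + 2 * (∫ x, a x ∂P) * ∫ y, b y ∂Q := by
  have h := integral_mul_add P Q (a.comp ContinuousMap.fst + b.comp ContinuousMap.snd) a b
  have h1 : ∀ x, fstMarginal Q (a.comp ContinuousMap.fst + b.comp ContinuousMap.snd) x =
      a x + ∫ y, b y ∂Q := fun x => by
    simp [integral_add (integrable_const (a x)) (b.continuous.integrable_of_compactSpace (μ := Q))]
  have h2 : ∀ y, sndMarginal P (a.comp ContinuousMap.fst + b.comp ContinuousMap.snd) y =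
      (∫ x, a x ∂P) + b y := fun y => by
    simp [integral_add (a.continuous.integrable_of_compactSpace (μ := P)) (integrable_const (b y))]
  simp only [h1, h2] at h
  have h0 : ∀ z : X × Y, (a.comp ContinuousMap.fst + b.comp ContinuousMap.snd : C(X × Y, ℝ)) z *
      (a z.1 + b z.2) = (a z.1 + b z.2) ^ 2 := fun z => (pow_two _).symm
  simp only [h0] at h
  have h3 : ∫ x, a x * (a x + ∫ y, b y ∂Q) ∂P =
      ∫ x, a x ^ 2 ∂P + (∫ x, a x ∂P) * ∫ y, b y ∂Q := by
    rw [← integral_mul_const, ← integral_add (Continuous.integrable_of_compactSpace (by fun_prop))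
      (Continuous.integrable_of_compactSpace (by fun_prop))]
    exact integral_congr_ae (.of_forall fun x => by ring)
  have h4 : ∫ y, b y * ((∫ x, a x ∂P) + b y) ∂Q =
      ∫ y, b y ^ 2 ∂Q + (∫ x, a x ∂P) * ∫ y, b y ∂Q := by
    rw [← integral_const_mul, ← integral_add (Continuous.integrable_of_compactSpace (by fun_prop))
      (Continuous.integrable_of_compactSpace (by fun_prop))]
    exact integral_congr_ae (.of_forall fun x => by ring)
  rw [h, h3, h4, sqNorm]
  ring

/-- On pairs with equal means, the operator `(a, b) ↦ a ⊕ b` has squared norm at most `2`, and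
strictly less after multiplication by a weight `√(1 - σ)` with `∫ σ > 0`: the norm is attained only
at constants, where the weight is felt. -/
lemma integral_one_sub_mul_sq_le {σ : X × Y → ℝ} (hσ : Continuous σ) (hσ0 : ∀ z, 0 ≤ σ z)
    (hσ1 : ∀ z, σ z ≤ 1) (a : C(X, ℝ)) (b : C(Y, ℝ)) (hab : ∫ x, a x ∂P = ∫ y, b y ∂Q) :
    ∫ z, (1 - σ z) * (a z.1 + b z.2) ^ 2 ∂(P.prod Q) ≤
      (2 - (∫ z, σ z ∂(P.prod Q)) / 2) * sqNorm P Q a b := by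
  set m := ∫ y, b y ∂Q with hm
  have hcont : Continuous fun z : X × Y => a z.1 + b z.2 := by fun_prop
  have hmean : ∫ z : X × Y, (a z.1 + b z.2) ∂(P.prod Q) = 2 * m := by
    have := integral_mul_add P Q 1 a b
    simp only [ContinuousMap.one_apply, one_mul, fstMarginal_apply, sndMarginal_apply,
      integral_const, probReal_univ, smul_eq_mul, mul_one] at this
    rw [this, hab]
    ring
  have h1 := integral_add_sq P Q a b
  have h2 := (hcont.memLp_of_compactSpace (μ := P.prod Q) 2).integral_add_const_sq (-(2 * m))
  rw [hmean] at h2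
  rw [hab, ← hm] at h1
  have h3 : ∫ z, (1 - σ z) * (a z.1 + b z.2) ^ 2 ∂(P.prod Q) ≤
      ∫ z : X × Y, ((a z.1 + b z.2) ^ 2 - m ^ 2 * σ z +
        1 / 2 * (a z.1 + b z.2 + -(2 * m)) ^ 2) ∂(P.prod Q) := by
    refine integral_mono (Continuous.integrable_of_compactSpace (by fun_prop))
      (Continuous.integrable_of_compactSpace (by fun_prop)) fun z => ?_
    have e0 := hσ0 z
    have e1 := hσ1 z
    dsimp only
    generalize σ z = s at *
    generalize a z.1 + b z.2 = r at *
    nlinarith [mul_nonneg e0 (sq_nonneg (r - m)), mul_nonneg e0 (sq_nonneg r),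
      mul_nonneg (sub_nonneg.2 e1) (sq_nonneg (r - 2 * m))]
  rw [integral_add (Continuous.integrable_of_compactSpace (by fun_prop))
    (Continuous.integrable_of_compactSpace (by fun_prop)),
    integral_sub (Continuous.integrable_of_compactSpace (by fun_prop))
    (Continuous.integrable_of_compactSpace (by fun_prop)), integral_const_mul, integral_const_mul,
    h1, h2, h1] at h3
  have h4 : m ^ 2 ≤ ∫ y, b y ^ 2 ∂Q := sq_integral_le_integral_sq Q b
  have h5 : m ^ 2 ≤ ∫ x, a x ^ 2 ∂P := hab ▸ sq_integral_le_integral_sq P a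
  have h6 : 2 * m ^ 2 ≤ sqNorm P Q a b := by
    rw [sqNorm]
    linarith
  have h7 : ∫ z, σ z ∂(P.prod Q) ≤ 1 := by
    have := integral_mono (μ := P.prod Q) (hσ.integrable_of_compactSpace) (integrable_const 1) hσ1
    simpa using this
  nlinarith

lemma integral_add_sq_le (a : C(X, ℝ)) (b : C(Y, ℝ)) (hab : ∫ x, a x ∂P = ∫ y, b y ∂Q) :
    ∫ z, (a z.1 + b z.2) ^ 2 ∂(P.prod Q) ≤ 2 * sqNorm P Q a b := by
  simpa using integral_one_sub_mul_sq_le P Q (σ := 0) continuous_zero (by simp) (by simp) a b hab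

lemma fstMarginal_sub (F G : C(X × Y, ℝ)) :
    fstMarginal Q (F - G) = fstMarginal Q F - fstMarginal Q G := by
  ext x
  exact integral_sub (Continuous.integrable_of_compactSpace (by fun_prop))
    (Continuous.integrable_of_compactSpace (by fun_prop))

lemma sndMarginal_sub (F G : C(X × Y, ℝ)) :
    sndMarginal P (F - G) = sndMarginal P F - sndMarginal P G := by
  ext x
  exact integral_sub (Continuous.integrable_of_compactSpace (by fun_prop))
    (Continuous.integrable_of_compactSpace (by fun_prop))

lemma integral_sub_smul_sq (a p : C(X, ℝ)) (τ : ℝ) :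
    ∫ x, (a - τ • p) x ^ 2 ∂P =
      ∫ x, a x ^ 2 ∂P - 2 * τ * ∫ x, a x * p x ∂P + τ ^ 2 * ∫ x, p x ^ 2 ∂P := by
  rw [← integral_const_mul, ← integral_const_mul,
    ← integral_sub (Continuous.integrable_of_compactSpace (by fun_prop))
    (Continuous.integrable_of_compactSpace (by fun_prop)),
    ← integral_add (Continuous.integrable_of_compactSpace (by fun_prop))
    (Continuous.integrable_of_compactSpace (by fun_prop))]
  refine integral_congr_ae (.of_forall fun z => ?_)
  simp only [ContinuousMap.sub_apply, ContinuousMap.smul_apply, smul_eq_mul]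
  ring

lemma sqNorm_sub_smul (a p : C(X, ℝ)) (b q : C(Y, ℝ)) (τ : ℝ) :
    sqNorm P Q ⇑(a - τ • p) ⇑(b - τ • q) = sqNorm P Q a b -
      2 * τ * (∫ x, a x * p x ∂P + ∫ y, b y * q y ∂Q) + τ ^ 2 * sqNorm P Q p q := by
  rw [sqNorm, sqNorm, sqNorm, integral_sub_smul_sq, integral_sub_smul_sq]
  ring

/-- One gradient step contracts the distance to a zero `v` of the gradient, provided that the energy
of the difference is bounded below (constant `C`) and the operator `(p, q) ↦ p ⊕ q` is bounded
above (constant `κ`) on the region that matters. -/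
lemma sqNorm_gradStep_sub_le {c : C(X × Y, ℝ)} {ε τ B κ C : ℝ} {u v : C(X, ℝ) × C(Y, ℝ)}
    (hv₁ : fstMarginal Q (posSlack c v) = ContinuousMap.const X ε)
    (hv₂ : sndMarginal P (posSlack c v) = ContinuousMap.const Y ε)
    (hB : 0 < B) (hu : ∀ z : X × Y, |u.1 z.1 + u.2 z.2 - c z| ≤ B)
    (hκ : 0 < κ) (hτ : 0 ≤ τ) (hτκ : τ * κ ≤ 2) (hC : 0 < C)
    (hupper : ∀ (p : C(X, ℝ)) (q : C(Y, ℝ)), ∫ x, p x ∂P = ∫ y, q y ∂Q →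
      ∫ z : X × Y, (1 - max (-(v.1 z.1 + v.2 z.2 - c z)) 0 /
        (max (-(v.1 z.1 + v.2 z.2 - c z)) 0 + B)) * (p z.1 + q z.2) ^ 2 ∂(P.prod Q) ≤
        κ * sqNorm P Q p q)
    (hlower : sqNorm P Q ⇑(u.1 - v.1) ⇑(u.2 - v.2) ≤
      C * ∫ z : X × Y, max (v.1 z.1 + v.2 z.2 - c z) 0 / (max (v.1 z.1 + v.2 z.2 - c z) 0 + B) *
        ((u.1 - v.1) z.1 + (u.2 - v.2) z.2) ^ 2 ∂(P.prod Q)) :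
    sqNorm P Q ⇑((gradStep P Q c ε τ u).1 - v.1) ⇑((gradStep P Q c ε τ u).2 - v.2) ≤
      (1 - τ * (2 - τ * κ) / C) * sqNorm P Q ⇑(u.1 - v.1) ⇑(u.2 - v.2) := by
  set ψ : C(X × Y, ℝ) := posSlack c u - posSlack c v with hψ
  set a := u.1 - v.1 with ha
  set b := u.2 - v.2 with hb
  set p := fstMarginal Q ψ with hp
  set q := sndMarginal P ψ with hq
  have e1 : (gradStep P Q c ε τ u).1 - v.1 = a - τ • p := by
    rw [gradStep, hp, hψ, fstMarginal_sub, hv₁, ha]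
    simp only [smul_sub]
    abel
  have e2 : (gradStep P Q c ε τ u).2 - v.2 = b - τ • q := by
    rw [gradStep, hq, hψ, sndMarginal_sub, hv₂, hb]
    simp only [smul_sub]
    abel
  have hpq : ∫ x, p x ∂P = ∫ y, q y ∂Q := by
    rw [integral_fstMarginal, integral_sndMarginal]
  have hD := integral_mul_add P Q ψ a b
  have hN := integral_mul_add P Q ψ p q
  simp only [← hp, ← hq, ← pow_two] at hN
  change _ = sqNorm P Q p q at hN
  rw [e1, e2, sqNorm_sub_smul, ← hD]
  set D := ∫ z : X × Y, ψ z * (a z.1 + b z.2) ∂(P.prod Q) with hDdef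
  have hab : ∀ z : X × Y, a z.1 + b z.2 =
      (u.1 z.1 + u.2 z.2 - c z) - (v.1 z.1 + v.2 z.2 - c z) := fun z => by
    simp only [ha, hb, ContinuousMap.sub_apply]
    ring
  have hden : ∀ t : ℝ, max t 0 + B ≠ 0 := fun t => by positivity
  have hlow : sqNorm P Q a b ≤ C * D := by
    refine hlower.trans (mul_le_mul_of_nonneg_left ?_ hC.le)
    refine integral_mono (Continuous.integrable_of_compactSpace ?_)
      (Continuous.integrable_of_compactSpace (by fun_prop)) fun z => ?_
    · fun_prop (disch := exact fun _ => hden _)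
    · dsimp only
      rw [hab]
      exact weight_mul_sq_le hB (hu z)
  have hup : sqNorm P Q p q ≤ κ * D := by
    have h1 : ∫ z : X × Y, ψ z * (p z.1 + q z.2) ∂(P.prod Q) ≤
        ∫ z : X × Y, (κ / 2 * (ψ z * (a z.1 + b z.2)) + 1 / (2 * κ) *
          ((1 - max (-(v.1 z.1 + v.2 z.2 - c z)) 0 /
            (max (-(v.1 z.1 + v.2 z.2 - c z)) 0 + B)) * (p z.1 + q z.2) ^ 2)) ∂(P.prod Q) := by
      refine integral_mono (Continuous.integrable_of_compactSpace (by fun_prop))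
        (Continuous.integrable_of_compactSpace ?_) fun z => ?_
      · fun_prop (disch := exact fun _ => hden _)
      · dsimp only
        rw [hab]
        exact posPart_sub_mul_le hB (hu z) hκ _
    rw [integral_add (Continuous.integrable_of_compactSpace (by fun_prop))
      (Continuous.integrable_of_compactSpace (by fun_prop (disch := exact fun _ => hden _))),
      integral_const_mul, integral_const_mul, hN] at h1
    have h2 := mul_le_mul_of_nonneg_left (hupper p q hpq) (by positivity : 0 ≤ 1 / (2 * κ))
    have h3 : 1 / (2 * κ) * (κ * sqNorm P Q p q) = sqNorm P Q p q / 2 := by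
      field_simp
    linarith
  have h1 : τ ^ 2 * sqNorm P Q p q ≤ τ ^ 2 * (κ * D) := mul_le_mul_of_nonneg_left hup (sq_nonneg τ)
  have h2 : sqNorm P Q a b / C ≤ D := by
    rw [div_le_iff₀ hC, mul_comm]
    exact hlow
  have h3 : 0 ≤ τ * (2 - τ * κ) := mul_nonneg hτ (by linarith)
  have h4 := mul_le_mul_of_nonneg_left h2 h3
  have h5 : τ * (2 - τ * κ) * (sqNorm P Q a b / C) =
    τ * (2 - τ * κ) / C * sqNorm P Q a b := by ring
  linarith

lemma exists_fst_slack_pos {c : C(X × Y, ℝ)} {ε : ℝ} {v : C(X, ℝ) × C(Y, ℝ)} (hε : 0 < ε)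
    (hv₂ : sndMarginal P (posSlack c v) = ContinuousMap.const Y ε) (y : Y) :
    ∃ x, 0 < v.1 x + v.2 y - c (x, y) := by
  by_contra! hneg
  have := DFunLike.congr_fun hv₂ y
  simp only [sndMarginal_apply, posSlack_apply, max_eq_right (hneg _), integral_zero,
    ContinuousMap.const_apply] at this
  exact hε.ne this

lemma exists_snd_slack_pos {c : C(X × Y, ℝ)} {ε : ℝ} {v : C(X, ℝ) × C(Y, ℝ)} (hε : 0 < ε)
    (hv₁ : fstMarginal Q (posSlack c v) = ContinuousMap.const X ε) (x : X) :
    ∃ y, 0 < v.1 x + v.2 y - c (x, y) := by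
  by_contra! hneg
  have := DFunLike.congr_fun hv₁ x
  simp only [fstMarginal_apply, posSlack_apply, max_eq_right (hneg _), integral_zero,
    ContinuousMap.const_apply] at this
  exact hε.ne this

/-- **Linear contraction** of the gradient step towards a zero `v` of the gradient, uniformly over
all pairs whose slack is bounded by `B`. For `τ = 1` the slack of `v` has to be negative
somewhere: otherwise the step may reflect constants. -/
theorem exists_sqNorm_gradStep_sub_le [P.IsOpenPosMeasure] [Q.IsOpenPosMeasure] [ConnectedSpace Y]
    {c : C(X × Y, ℝ)} {ε τ B : ℝ} {v : C(X, ℝ) × C(Y, ℝ)} (hε : 0 < ε)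
    (hv₁ : fstMarginal Q (posSlack c v) = ContinuousMap.const X ε)
    (hv₂ : sndMarginal P (posSlack c v) = ContinuousMap.const Y ε)
    (hv : ∫ x, v.1 x ∂P = ∫ y, v.2 y ∂Q) (hB : 0 < B) (hτ : 0 < τ)
    (hτ1 : τ < 1 ∨ τ = 1 ∧ ∃ z : X × Y, v.1 z.1 + v.2 z.2 - c z < 0) :
    ∃ ρ : ℝ, 0 < ρ ∧ ρ < 1 ∧ ∀ u : C(X, ℝ) × C(Y, ℝ), ∫ x, u.1 x ∂P = ∫ y, u.2 y ∂Q →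
      (∀ z : X × Y, |u.1 z.1 + u.2 z.2 - c z| ≤ B) →
      sqNorm P Q ⇑((gradStep P Q c ε τ u).1 - v.1) ⇑((gradStep P Q c ε τ u).2 - v.2) ≤
        ρ * sqNorm P Q ⇑(u.1 - v.1) ⇑(u.2 - v.2) := by
  have hden : ∀ t : ℝ, max t 0 + B ≠ 0 := fun t => by positivity
  obtain ⟨C, hC, hgap⟩ := exists_integral_sq_add_integral_sq_le P Q
    (ω := fun z => max (v.1 z.1 + v.2 z.2 - c z) 0 / (max (v.1 z.1 + v.2 z.2 - c z) 0 + B))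
    (by fun_prop (disch := exact fun _ => hden _)) (fun z => by positivity)
    (fun y => by
      obtain ⟨x, hx⟩ := exists_fst_slack_pos P hε hv₂ y
      exact ⟨x, by have := lt_max_of_lt_left (c := 0) hx; positivity⟩)
    (fun x => by
      obtain ⟨y, hy⟩ := exists_snd_slack_pos Q hε hv₁ x
      exact ⟨y, by have := lt_max_of_lt_left (c := 0) hy; positivity⟩)
  have hσ : Continuous fun z : X × Y => max (-(v.1 z.1 + v.2 z.2 - c z)) 0 /
      (max (-(v.1 z.1 + v.2 z.2 - c z)) 0 + B) := by
    fun_prop (disch := exact fun _ => hden _)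
  have hσ0 : ∀ z : X × Y, 0 ≤ max (-(v.1 z.1 + v.2 z.2 - c z)) 0 /
      (max (-(v.1 z.1 + v.2 z.2 - c z)) 0 + B) := fun z => by positivity
  have hσ1 : ∀ z : X × Y, max (-(v.1 z.1 + v.2 z.2 - c z)) 0 /
      (max (-(v.1 z.1 + v.2 z.2 - c z)) 0 + B) ≤ 1 := fun z => by
    rw [div_le_one (by positivity)]
    linarith
  set s := ∫ z : X × Y, max (-(v.1 z.1 + v.2 z.2 - c z)) 0 /
    (max (-(v.1 z.1 + v.2 z.2 - c z)) 0 + B) ∂(P.prod Q) with hs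
  have hs0 : 0 ≤ s := integral_nonneg hσ0
  have hs1 : s ≤ 1 := by
    have := integral_mono (μ := P.prod Q) (hσ.integrable_of_compactSpace) (integrable_const 1) hσ1
    exact this.trans (by simp)
  have hτκ : τ * (2 - s / 2) < 2 := by
    rcases hτ1 with h | ⟨rfl, z, hz⟩
    · nlinarith
    · have : 0 < s := by
        refine hσ.integral_pos_of_hasCompactSupport_nonneg_nonzero
          (HasCompactSupport.of_compactSpace _) hσ0 (x := z) (ne_of_gt ?_)
        have : 0 < max (-(v.1 z.1 + v.2 z.2 - c z)) 0 := lt_max_of_lt_left (by linarith)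
        positivity
      linarith
  have hpos : 0 < τ * (2 - τ * (2 - s / 2)) := mul_pos hτ (by linarith)
  -- the maximum with `1 / 2` only ensures that the factor is positive
  refine ⟨max (1 - τ * (2 - τ * (2 - s / 2)) / C) (1 / 2), by positivity,
    max_lt (by have := div_pos hpos hC; linarith) (by norm_num), fun u hu huB => ?_⟩
  have key := sqNorm_gradStep_sub_le P Q (τ := τ) (κ := 2 - s / 2) (C := C) hv₁ hv₂ hB huB
    (by linarith) hτ.le hτκ.le hC
    (fun p q hpq => integral_one_sub_mul_sq_le P Q hσ hσ0 hσ1 p q hpq)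
    (hgap _ _ ((u.1 - v.1).continuous.memLp_of_compactSpace 2)
      ((u.2 - v.2).continuous.memLp_of_compactSpace 2) (by
      simp only [ContinuousMap.sub_apply]
      rw [integral_sub u.1.continuous.integrable_of_compactSpace
        v.1.continuous.integrable_of_compactSpace, integral_sub
        u.2.continuous.integrable_of_compactSpace v.2.continuous.integrable_of_compactSpace,
        hu, hv]))
  exact key.trans (mul_le_mul_of_nonneg_right (le_max_left _ _) (sqNorm_nonneg P Q _ _))

end Operators

/-! ### Bounded invariant sets and existence of potentials -/

/-- The map `(a, s) ↦ a - τ (a + s)₊` replaces a difference of `a` by an average of it with a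
difference of `-s`. -/
lemma abs_sub_mul_posPart_sub_le {a a' s s' m τ : ℝ} (hτ0 : 0 ≤ τ) (hτ1 : τ ≤ 1)
    (ha : |a - a'| ≤ m) (hs : |s - s'| ≤ m) :
    |(a - τ * max (a + s) 0) - (a' - τ * max (a' + s') 0)| ≤ m := by
  obtain ⟨θ, h0, h1, h2⟩ := exists_posPart_sub_eq_mul (s := a + s) (t := a' + s')
    (B := |a + s| + 1) (by positivity) (by linarith)
  have h1 : θ ≤ 1 := h1.trans (sub_le_self _ (by positivity))
  have e : (a - τ * max (a + s) 0) - (a' - τ * max (a' + s') 0) =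
      (1 - τ * θ) * (a - a') - τ * θ * (s - s') := by
    linear_combination (-τ) * h2
  have h3 : 0 ≤ τ * θ := mul_nonneg hτ0 h0
  have h4 : τ * θ ≤ 1 := mul_le_one₀ hτ1 h0 h1
  rw [abs_le] at *
  rw [e]
  constructor <;> nlinarith

section Invariance

variable {X Y : Type*} [TopologicalSpace X] [MeasurableSpace X] [BorelSpace X] [CompactSpace X]
  [SecondCountableTopology X]
  [TopologicalSpace Y] [MeasurableSpace Y] [BorelSpace Y] [CompactSpace Y]
  [SecondCountableTopology Y] (P : Measure X) (Q : Measure Y)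
  [IsProbabilityMeasure P] [IsProbabilityMeasure Q]

/-- The two components of the gradient step exchange their roles when `X` and `Y` do. -/
lemma gradStep_snd (c : C(X × Y, ℝ)) (ε τ : ℝ) (u : C(X, ℝ) × C(Y, ℝ)) :
    (gradStep P Q c ε τ u).2 =
      (gradStep Q P (c.comp ContinuousMap.prodSwap) ε τ u.swap).1 := by
  have : (posSlack c u).comp ContinuousMap.prodSwap =
      posSlack (c.comp ContinuousMap.prodSwap) u.swap := by
    ext z
    simp [add_comm]
  rw [gradStep, gradStep, sndMarginal, this]
  rfl

/-- A gradient step preserves bounds on oscillations that also hold for the cost. -/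
lemma abs_gradStep_fst_sub_le {c : C(X × Y, ℝ)} {ε τ m : ℝ} {u : C(X, ℝ) × C(Y, ℝ)}
    (hτ0 : 0 ≤ τ) (hτ1 : τ ≤ 1) {x x' : X} (hu : |u.1 x - u.1 x'| ≤ m)
    (hc : ∀ y, |c (x, y) - c (x', y)| ≤ m) :
    |(gradStep P Q c ε τ u).1 x - (gradStep P Q c ε τ u).1 x'| ≤ m := by
  have hi : ∀ x, Integrable (fun y => u.1 x - τ * max (u.1 x + (u.2 y - c (x, y))) 0) Q :=
    fun x => Continuous.integrable_of_compactSpace (by fun_prop)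
  have h : ∀ x, (gradStep P Q c ε τ u).1 x =
      τ * ε + ∫ y, (u.1 x - τ * max (u.1 x + (u.2 y - c (x, y))) 0) ∂Q := fun x => by
    rw [integral_sub (integrable_const _) (Continuous.integrable_of_compactSpace (by fun_prop)),
      integral_const_mul]
    simp only [gradStep, ContinuousMap.add_apply, ContinuousMap.smul_apply,
      ContinuousMap.sub_apply, ContinuousMap.const_apply, fstMarginal_apply, posSlack_apply,
      smul_eq_mul, integral_const, probReal_univ, one_mul, add_sub_assoc]
    ring
  rw [h, h, add_sub_add_left_eq_sub, ← integral_sub (hi x) (hi x')]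
  have := norm_integral_le_of_norm_le_const (μ := Q) (C := m)
    (f := fun y => (u.1 x - τ * max (u.1 x + (u.2 y - c (x, y))) 0) -
      (u.1 x' - τ * max (u.1 x' + (u.2 y - c (x', y))) 0)) (.of_forall fun y =>
      abs_sub_mul_posPart_sub_le hτ0 hτ1 hu (by
        rw [sub_sub_sub_cancel_left, abs_sub_comm]
        exact hc y))
  simpa using this

lemma integral_gradStep_fst (c : C(X × Y, ℝ)) (ε τ : ℝ) (u : C(X, ℝ) × C(Y, ℝ)) :
    ∫ x, (gradStep P Q c ε τ u).1 x ∂P =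
      ∫ x, u.1 x ∂P + τ * (ε - ∫ z, posSlack c u z ∂(P.prod Q)) := by
  rw [← integral_fstMarginal]
  simp only [gradStep, ContinuousMap.add_apply, ContinuousMap.smul_apply, ContinuousMap.sub_apply,
    ContinuousMap.const_apply, smul_eq_mul]
  rw [integral_add (Continuous.integrable_of_compactSpace (by fun_prop))
    (Continuous.integrable_of_compactSpace (by fun_prop)), integral_const_mul,
    integral_sub (integrable_const _) (Continuous.integrable_of_compactSpace (by fun_prop))]
  simp

lemma integral_gradStep_snd (c : C(X × Y, ℝ)) (ε τ : ℝ) (u : C(X, ℝ) × C(Y, ℝ)) :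
    ∫ y, (gradStep P Q c ε τ u).2 y ∂Q =
      ∫ y, u.2 y ∂Q + τ * (ε - ∫ z, posSlack c u z ∂(P.prod Q)) := by
  rw [← integral_sndMarginal]
  simp only [gradStep, ContinuousMap.add_apply, ContinuousMap.smul_apply, ContinuousMap.sub_apply,
    ContinuousMap.const_apply, smul_eq_mul]
  rw [integral_add (Continuous.integrable_of_compactSpace (by fun_prop))
    (Continuous.integrable_of_compactSpace (by fun_prop)), integral_const_mul,
    integral_sub (integrable_const _) (Continuous.integrable_of_compactSpace (by fun_prop))]
  simp

/-- The pairs of continuous functions with moduli of continuity `mX` and `mY`, whose means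
are equal and lie in `[-(H + R), H]`. The interval is asymmetric because a step with `τ ≤ 1` from
a mean `a` near `H` can overshoot to about `-a - R`, where `R` bounds the deviation of the slack
from `2 a`. -/
def boundedPairs (mX : X → X → ℝ) (mY : Y → Y → ℝ) (H R : ℝ) : Set (C(X, ℝ) × C(Y, ℝ)) :=
  {u | (∀ x x', |u.1 x - u.1 x'| ≤ mX x x') ∧ (∀ y y', |u.2 y - u.2 y'| ≤ mY y y') ∧
    ∫ x, u.1 x ∂P = ∫ y, u.2 y ∂Q ∧ -(H + R) ≤ ∫ x, u.1 x ∂P ∧ ∫ x, u.1 x ∂P ≤ H}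

variable {P Q}

lemma abs_sub_integral_le {f : C(X, ℝ)} {M : ℝ} (hf : ∀ x x', |f x - f x'| ≤ M) (x : X) :
    |f x - ∫ x', f x' ∂P| ≤ M := by
  have := norm_integral_le_of_norm_le_const (μ := P) (f := fun x' => f x - f x')
    (.of_forall fun x' => hf x x')
  rw [integral_sub (integrable_const _) (Continuous.integrable_of_compactSpace (by fun_prop))]
    at this
  simpa using this

lemma abs_slack_sub_le {mX : X → X → ℝ} {mY : Y → Y → ℝ} {H R M Mc : ℝ} {c : C(X × Y, ℝ)}
    {u : C(X, ℝ) × C(Y, ℝ)} (hu : u ∈ boundedPairs P Q mX mY H R) (hX : ∀ x x', mX x x' ≤ M)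
    (hY : ∀ y y', mY y y' ≤ M) (hc : ∀ z, |c z| ≤ Mc) (z : X × Y) :
    |u.1 z.1 + u.2 z.2 - c z - 2 * ∫ x, u.1 x ∂P| ≤ 2 * M + Mc := by
  have h1 := abs_sub_integral_le (P := P) (fun x x' => (hu.1 x x').trans (hX x x')) z.1
  have h2 := abs_sub_integral_le (P := Q) (fun x x' => (hu.2.1 x x').trans (hY x x')) z.2
  have h3 := hc z
  rw [← hu.2.2.1] at h2
  rw [abs_le] at *
  constructor <;> linarith

lemma abs_slack_le {mX : X → X → ℝ} {mY : Y → Y → ℝ} {H R M Mc : ℝ} {c : C(X × Y, ℝ)}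
    {u : C(X, ℝ) × C(Y, ℝ)} (hu : u ∈ boundedPairs P Q mX mY H R) (hX : ∀ x x', mX x x' ≤ M)
    (hY : ∀ y y', mY y y' ≤ M) (hc : ∀ z, |c z| ≤ Mc) (hR : 0 ≤ R) (z : X × Y) :
    |u.1 z.1 + u.2 z.2 - c z| ≤ 2 * M + Mc + 2 * (H + R) := by
  have h := abs_slack_sub_le hu hX hY hc z
  have h1 := hu.2.2.2.1
  have h2 := hu.2.2.2.2
  rw [abs_le] at *
  constructor <;> linarith

/-- The gradient step with `τ ≤ 1` preserves a modulus of continuity that is also one of the cost,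
and pushes the means back when they leave a bounded interval. -/
lemma gradStep_mem_boundedPairs {mX : X → X → ℝ} {mY : Y → Y → ℝ} {H R M Mc ε τ : ℝ}
    {c : C(X × Y, ℝ)} {u : C(X, ℝ) × C(Y, ℝ)} (hu : u ∈ boundedPairs P Q mX mY H R)
    (hX : ∀ x x', mX x x' ≤ M) (hY : ∀ y y', mY y y' ≤ M) (hc : ∀ z, |c z| ≤ Mc)
    (hcX : ∀ x x' y, |c (x, y) - c (x', y)| ≤ mX x x')
    (hcY : ∀ x y y', |c (x, y) - c (x, y')| ≤ mY y y') (hR : 2 * M + Mc ≤ R)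
    (hH : (3 * ε + R) / 2 ≤ H) (hε : 0 ≤ ε) (hτ0 : 0 ≤ τ) (hτ1 : τ ≤ 1) :
    gradStep P Q c ε τ u ∈ boundedPairs P Q mX mY H R := by
  refine ⟨fun x x' => abs_gradStep_fst_sub_le P Q hτ0 hτ1 (hu.1 x x') (hcX x x'),
    fun y y' => ?_, ?_, ?_⟩
  · rw [gradStep_snd]
    exact abs_gradStep_fst_sub_le Q P hτ0 hτ1 (hu.2.1 y y') fun x => hcY x y y'
  · rw [integral_gradStep_fst, integral_gradStep_snd, hu.2.2.1]
  rw [integral_gradStep_fst]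
  have hs := abs_slack_sub_le hu hX hY hc
  have h1 := hu.2.2.2.1
  have h2 := hu.2.2.2.2
  set a := ∫ x, u.1 x ∂P
  have hint : Integrable (fun z => posSlack c u z) (P.prod Q) :=
    Continuous.integrable_of_compactSpace (by fun_prop)
  have hlow : max (2 * a - R) 0 ≤ ∫ z, posSlack c u z ∂(P.prod Q) := by
    have := integral_mono (μ := P.prod Q) (integrable_const (max (2 * a - R) 0)) hint fun z =>
      max_le_max_right 0 (by have := (abs_le.1 (hs z)).1; linarith)
    simpa using this
  have hup : ∫ z, posSlack c u z ∂(P.prod Q) ≤ max (2 * a + R) 0 := by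
    have := integral_mono (μ := P.prod Q) hint (integrable_const (max (2 * a + R) 0)) fun z =>
      max_le_max_right 0 (by have := (abs_le.1 (hs z)).2; linarith)
    simpa using this
  set I := ∫ z, posSlack c u z ∂(P.prod Q)
  have hlow1 := (le_max_left _ _).trans hlow
  have hlow2 := (le_max_right _ _).trans hlow
  constructor
  · rcases le_total (2 * a + R) 0 with h | h
    · rw [max_eq_right h] at hup
      nlinarith
    · rw [max_eq_left h] at hup
      have : τ * (ε - (2 * a + R)) ≤ τ * (ε - I) := mul_le_mul_of_nonneg_left (by linarith) hτ0
      rcases le_total (2 * a + R) ε with h' | h'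
      · nlinarith
      · nlinarith
  · rcases le_total ε (2 * a - R) with h | h
    · nlinarith
    · nlinarith

end Invariance

section Existence

variable {X Y : Type*} [TopologicalSpace X] [MeasurableSpace X] [BorelSpace X] [CompactSpace X]
  [SecondCountableTopology X]
  [TopologicalSpace Y] [MeasurableSpace Y] [BorelSpace Y] [CompactSpace Y]
  [SecondCountableTopology Y] (P : Measure X) (Q : Measure Y)
  [IsProbabilityMeasure P] [IsProbabilityMeasure Q]

lemma continuous_integral_continuousMap : Continuous fun F : C(X, ℝ) => ∫ x, F x ∂P := by
  refine (LipschitzWith.of_dist_le_mul (K := 1) fun F G => ?_).continuous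
  rw [dist_eq_norm, ← integral_sub F.continuous.integrable_of_compactSpace
    G.continuous.integrable_of_compactSpace, NNReal.coe_one, one_mul, dist_eq_norm]
  have := norm_integral_le_of_norm_le_const (μ := P) (f := fun x => F x - G x)
    (.of_forall fun x => (F - G).norm_coe_le_norm x)
  simpa using this

lemma continuous_posSlack (c : C(X × Y, ℝ)) : Continuous (posSlack c) := by
  refine (LipschitzWith.of_dist_le_mul (K := 2) fun u v => ?_).continuous
  refine (ContinuousMap.dist_le (by positivity)).2 fun z => ?_
  have h1 := (ContinuousMap.dist_apply_le_dist (f := u.1) (g := v.1) z.1).trans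
    (le_max_left _ (dist u.2 v.2))
  have h2 := (ContinuousMap.dist_apply_le_dist (f := u.2) (g := v.2) z.2).trans
    (le_max_right (dist u.1 v.1) _)
  rw [← Prod.dist_eq, Real.dist_eq] at h1 h2
  rw [Real.dist_eq, posSlack_apply, posSlack_apply]
  refine (abs_max_sub_max_le_abs _ _ _).trans ?_
  rw [NNReal.coe_ofNat, abs_le]
  rw [abs_le] at h1 h2
  constructor <;> linarith

/-- A set of functions with a common modulus of continuity and a common bound is compact. -/
lemma isCompact_setOf_modulus {m : X → X → ℝ} (hm : ∀ x, Tendsto (m x) (𝓝 x) (𝓝 0)) (K : ℝ) :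
    IsCompact {f : C(X, ℝ) | (∀ x x', |f x - f x'| ≤ m x x') ∧ ∀ x, |f x| ≤ K} := by
  refine ArzelaAscoli.isCompact_of_equicontinuous _ ?_ fun x =>
    Metric.equicontinuousAt_of_continuity_modulus (m x) (hm x) _
      (.of_forall fun x' f => f.2.1 x x')
  have himage : ContinuousMap.toFun '' {f : C(X, ℝ) | (∀ x x', |f x - f x'| ≤ m x x') ∧
      ∀ x, |f x| ≤ K} = {f : X → ℝ | (∀ x x', |f x - f x'| ≤ m x x') ∧ ∀ x, |f x| ≤ K} := by
    ext f
    constructor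
    · rintro ⟨f, hf, rfl⟩
      exact hf
    · intro hf
      refine ⟨⟨f, continuous_iff_continuousAt.2 fun x => ?_⟩, hf, rfl⟩
      refine tendsto_iff_dist_tendsto_zero.2 (squeeze_zero (fun _ => dist_nonneg) (fun x' => ?_)
        (hm x))
      rw [dist_comm]
      exact hf.1 x x'
  rw [himage]
  refine (isCompact_univ_pi fun _ : X => isCompact_Icc (a := -K) (b := K)).of_isClosed_subset ?_
    fun f hf x _ => abs_le.1 (hf.2 x)
  simp only [ofPred_and, ofPred_forall]
  refine (isClosed_iInter fun x => isClosed_iInter fun x' => ?_).inter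
    (isClosed_iInter fun x => ?_)
  · exact isClosed_le (by fun_prop) continuous_const
  · exact isClosed_le (by fun_prop) continuous_const

lemma isCompact_boundedPairs {mX : X → X → ℝ} {mY : Y → Y → ℝ} {H R M : ℝ} (hR : 0 ≤ R)
    (hmX : ∀ x, Tendsto (mX x) (𝓝 x) (𝓝 0)) (hmY : ∀ y, Tendsto (mY y) (𝓝 y) (𝓝 0))
    (hX : ∀ x x', mX x x' ≤ M) (hY : ∀ y y', mY y y' ≤ M) :
    IsCompact (boundedPairs P Q mX mY H R) := by
  refine ((isCompact_setOf_modulus hmX (M + (H + R))).prod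
    (isCompact_setOf_modulus hmY (M + (H + R)))).of_isClosed_subset ?_ ?_
  · have h1 : Continuous fun u : C(X, ℝ) × C(Y, ℝ) => ∫ x, u.1 x ∂P :=
      (continuous_integral_continuousMap P).comp continuous_fst
    have h2 : Continuous fun u : C(X, ℝ) × C(Y, ℝ) => ∫ x, u.2 x ∂Q :=
      (continuous_integral_continuousMap Q).comp continuous_snd
    simp only [boundedPairs, ofPred_and, ofPred_forall]
    refine (isClosed_iInter fun x => isClosed_iInter fun x' => ?_).inter
      ((isClosed_iInter fun x => isClosed_iInter fun x' => ?_).inter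
      ((isClosed_eq h1 h2).inter ((isClosed_le continuous_const h1).inter
        (isClosed_le h1 continuous_const))))
    · exact isClosed_le (by fun_prop) continuous_const
    · exact isClosed_le (by fun_prop) continuous_const
  · intro u hu
    refine ⟨⟨hu.1, fun x => ?_⟩, hu.2.1, fun y => ?_⟩
    · have h1 := abs_sub_integral_le (P := P) (fun x x' => (hu.1 x x').trans (hX x x')) x
      have h2 := hu.2.2.2.1
      have h3 := hu.2.2.2.2
      rw [abs_le] at *
      constructor <;> linarith
    · have h1 := abs_sub_integral_le (P := Q) (fun x x' => (hu.2.1 x x').trans (hY x x')) y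
      have h2 := hu.2.2.2.1
      have h3 := hu.2.2.2.2
      rw [← hu.2.2.1] at h1
      rw [abs_le] at *
      constructor <;> linarith

/-- The dual objective, multiplied by `ε`. -/
noncomputable def dualObjective (c : C(X × Y, ℝ)) (ε : ℝ) (u : C(X, ℝ) × C(Y, ℝ)) : ℝ :=
  ε * (∫ x, u.1 x ∂P + ∫ y, u.2 y ∂Q) - 1 / 2 * ∫ z, posSlack c u z ^ 2 ∂(P.prod Q)

lemma continuous_dualObjective (c : C(X × Y, ℝ)) (ε : ℝ) :
    Continuous (dualObjective P Q c ε) := by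
  have h1 : Continuous fun u : C(X, ℝ) × C(Y, ℝ) => ∫ x, u.1 x ∂P :=
    (continuous_integral_continuousMap P).comp continuous_fst
  have h2 : Continuous fun u : C(X, ℝ) × C(Y, ℝ) => ∫ x, u.2 x ∂Q :=
    (continuous_integral_continuousMap Q).comp continuous_snd
  have h3 : Continuous fun u : C(X, ℝ) × C(Y, ℝ) => ∫ z, posSlack c u z ^ 2 ∂(P.prod Q) :=
    (continuous_integral_continuousMap (P.prod Q)).comp ((continuous_posSlack c).pow 2)
  unfold dualObjective
  fun_prop

/-- A gradient step increases the dual objective by at least `τ (1 - τ)` times the squared norm of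
the residual. -/
lemma dualObjective_gradStep_ge (c : C(X × Y, ℝ)) (ε : ℝ) {τ : ℝ} (u : C(X, ℝ) × C(Y, ℝ)) :
    dualObjective P Q c ε u + (τ - τ ^ 2) *
      sqNorm P Q ⇑(ContinuousMap.const X ε - fstMarginal Q (posSlack c u))
        ⇑(ContinuousMap.const Y ε - sndMarginal P (posSlack c u)) ≤
      dualObjective P Q c ε (gradStep P Q c ε τ u) := by
  -- the residual `(r, s)` is `ε` times the gradient, and `(r ⊕ s)²` has integral at most twice its
  -- squared norm
  set F := posSlack c u with hF
  set r := ContinuousMap.const X ε - fstMarginal Q F with hr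
  set s := ContinuousMap.const Y ε - sndMarginal P F with hs
  have hrs : ∫ x, r x ∂P = ∫ y, s y ∂Q := by
    simp only [hr, hs, ContinuousMap.sub_apply, ContinuousMap.const_apply]
    rw [integral_sub (integrable_const _) (Continuous.integrable_of_compactSpace (by fun_prop)),
      integral_sub (integrable_const _) (Continuous.integrable_of_compactSpace (by fun_prop)),
      integral_fstMarginal, integral_sndMarginal]
    simp
  have hstep : gradStep P Q c ε τ u = (u.1 + τ • r, u.2 + τ • s) := rfl
  have hadj := integral_mul_add P Q F r s
  have hsq := integral_add_sq_le P Q r s hrs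
  have hquad : ∫ z, posSlack c (u.1 + τ • r, u.2 + τ • s) z ^ 2 ∂(P.prod Q) ≤
      ∫ z, (F z ^ 2 + 2 * τ * (F z * (r z.1 + s z.2)) + τ ^ 2 * (r z.1 + s z.2) ^ 2)
        ∂(P.prod Q) := by
    refine integral_mono (Continuous.integrable_of_compactSpace (by fun_prop))
      (Continuous.integrable_of_compactSpace (by fun_prop)) fun z => ?_
    simp only [hF, posSlack_apply, ContinuousMap.add_apply, ContinuousMap.smul_apply, smul_eq_mul]
    have e : u.1 z.1 + τ * r z.1 + (u.2 z.2 + τ * s z.2) - c z =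
      (u.1 z.1 + u.2 z.2 - c z) + τ * (r z.1 + s z.2) := by ring
    rw [e]
    generalize u.1 z.1 + u.2 z.2 - c z = t
    have e' : max t 0 ^ 2 + 2 * τ * (max t 0 * (r z.1 + s z.2)) + τ ^ 2 * (r z.1 + s z.2) ^ 2 =
      (max t 0 + τ * (r z.1 + s z.2)) ^ 2 := by ring
    rw [e']
    generalize τ * (r z.1 + s z.2) = w
    rcases le_total (t + w) 0 with h | h
    · rw [max_eq_right h, zero_pow two_ne_zero]
      exact sq_nonneg _
    · rw [max_eq_left h]
      exact pow_le_pow_left₀ h (by linarith [le_max_left t 0]) 2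
  rw [integral_add (Continuous.integrable_of_compactSpace (by fun_prop))
    (Continuous.integrable_of_compactSpace (by fun_prop)),
    integral_add (Continuous.integrable_of_compactSpace (by fun_prop))
    (Continuous.integrable_of_compactSpace (by fun_prop)), integral_const_mul,
    integral_const_mul, hadj] at hquad
  have hr2 : ∫ x, r x * fstMarginal Q F x ∂P = ε * ∫ x, r x ∂P - ∫ x, r x ^ 2 ∂P := by
    rw [← integral_const_mul, ← integral_sub (Continuous.integrable_of_compactSpace (by fun_prop))
      (Continuous.integrable_of_compactSpace (by fun_prop))]
    refine integral_congr_ae (.of_forall fun x => ?_)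
    have : fstMarginal Q F x = ε - r x := by simp [hr]
    simp only [this]
    ring
  have hs2 : ∫ y, s y * sndMarginal P F y ∂Q = ε * ∫ y, s y ∂Q - ∫ y, s y ^ 2 ∂Q := by
    rw [← integral_const_mul, ← integral_sub (Continuous.integrable_of_compactSpace (by fun_prop))
      (Continuous.integrable_of_compactSpace (by fun_prop))]
    refine integral_congr_ae (.of_forall fun x => ?_)
    have : sndMarginal P F x = ε - s x := by simp [hs]
    simp only [this]
    ring
  have hi1 : ∫ x, (u.1 + τ • r) x ∂P = ∫ x, u.1 x ∂P + τ * ∫ x, r x ∂P := by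
    rw [← integral_const_mul, ← integral_add (Continuous.integrable_of_compactSpace (by fun_prop))
      (Continuous.integrable_of_compactSpace (by fun_prop))]
    rfl
  have hi2 : ∫ y, (u.2 + τ • s) y ∂Q = ∫ y, u.2 y ∂Q + τ * ∫ y, s y ∂Q := by
    rw [← integral_const_mul, ← integral_add (Continuous.integrable_of_compactSpace (by fun_prop))
      (Continuous.integrable_of_compactSpace (by fun_prop))]
    rfl
  rw [hr2, hs2] at hquad
  rw [hstep, dualObjective, dualObjective, hi1, hi2, ← hF]
  have := mul_le_mul_of_nonneg_left hsq (sq_nonneg τ)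
  have hN : sqNorm P Q r s = ∫ x, r x ^ 2 ∂P + ∫ y, s y ^ 2 ∂Q := rfl
  rw [hN] at this ⊢
  linarith

lemma eq_zero_of_integral_sq_eq_zero [P.IsOpenPosMeasure] {r : C(X, ℝ)}
    (h : ∫ x, r x ^ 2 ∂P ≤ 0) : r = 0 := by
  by_contra hne
  obtain ⟨x, hx⟩ := DFunLike.ne_iff.1 hne
  refine h.not_gt (Continuous.integral_pos_of_hasCompactSupport_nonneg_nonzero (x := x)
    (by fun_prop) (HasCompactSupport.of_compactSpace _) (fun _ => sq_nonneg _) ?_)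
  exact pow_ne_zero 2 hx

/-- **Existence of potentials** among continuous functions: a maximizer of the dual objective
over a compact set that is invariant under gradient steps is a zero of the gradient. -/
theorem exists_marginal_posSlack_eq [P.IsOpenPosMeasure] [Q.IsOpenPosMeasure] (c : C(X × Y, ℝ))
    {ε : ℝ} (hε : 0 ≤ ε) :
    ∃ v : C(X, ℝ) × C(Y, ℝ), ∫ x, v.1 x ∂P = ∫ y, v.2 y ∂Q ∧
      fstMarginal Q (posSlack c v) = ContinuousMap.const X ε ∧
      sndMarginal P (posSlack c v) = ContinuousMap.const Y ε := by
  let cX : C(X, C(Y, ℝ)) := c.curry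
  let cY : C(Y, C(X, ℝ)) := (c.comp ContinuousMap.prodSwap).curry
  let mX : X → X → ℝ := fun x x' => ‖cX x - cX x'‖
  let mY : Y → Y → ℝ := fun y y' => ‖cY y - cY y'‖
  have hmX : ∀ x, Tendsto (mX x) (𝓝 x) (𝓝 0) := fun x => by
    have : Continuous (mX x) := by fun_prop
    simpa [mX] using this.tendsto x
  have hmY : ∀ y, Tendsto (mY y) (𝓝 y) (𝓝 0) := fun y => by
    have : Continuous (mY y) := by fun_prop
    simpa [mY] using this.tendsto y
  have hcX : ∀ x x' y, |c (x, y) - c (x', y)| ≤ mX x x' := fun x x' y =>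
    (cX x - cX x').norm_coe_le_norm y
  have hcY : ∀ x y y', |c (x, y) - c (x, y')| ≤ mY y y' := fun x y y' =>
    (cY y - cY y').norm_coe_le_norm x
  set M := 2 * ‖c‖
  have hX : ∀ x x', mX x x' ≤ M := fun x x' => by
    have h : ∀ x, ‖cX x‖ ≤ ‖c‖ := fun x => (ContinuousMap.norm_le _ (norm_nonneg c)).2
      fun y => c.norm_coe_le_norm (x, y)
    exact (norm_sub_le _ _).trans (by linarith [h x, h x'])
  have hY : ∀ x x', mY x x' ≤ M := fun x x' => by
    have h : ∀ x, ‖cY x‖ ≤ ‖c‖ := fun x => (ContinuousMap.norm_le _ (norm_nonneg c)).2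
      fun y => c.norm_coe_le_norm (y, x)
    exact (norm_sub_le _ _).trans (by linarith [h x, h x'])
  set R := 2 * M + ‖c‖
  have hR : 0 ≤ R := by positivity
  set H := (3 * ε + R) / 2
  have hH : 0 ≤ H := by positivity
  obtain ⟨v, hv, hmax⟩ := (isCompact_boundedPairs P Q (H := H) hR hmX hmY hX hY).exists_isMaxOn
    ⟨0, by
      refine ⟨fun x x' => ?_, fun y y' => ?_, by simp, ?_, ?_⟩
      · simp [mX]
      · simp [mY]
      · simp only [Prod.fst_zero, ContinuousMap.zero_apply, integral_zero]
        linarith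
      · simpa using hH⟩ (continuous_dualObjective P Q c ε).continuousOn
  -- any `τ` in `(0, 1)` makes the gain `τ - τ ^ 2` positive
  have h1 := hmax (gradStep_mem_boundedPairs (τ := 1 / 2) hv hX hY c.norm_coe_le_norm hcX hcY
    le_rfl le_rfl hε (by norm_num) (by norm_num))
  have h2 := dualObjective_gradStep_ge P Q c ε (τ := 1 / 2) v
  simp only [mem_ofPred_eq] at h1
  have h3 := h2.trans h1
  have hN : sqNorm P Q ⇑(ContinuousMap.const X ε - fstMarginal Q (posSlack c v))
        ⇑(ContinuousMap.const Y ε - sndMarginal P (posSlack c v)) ≤ 0 := by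
    norm_num at h3
    linarith
  have hn1 : 0 ≤ ∫ x, (ContinuousMap.const X ε - fstMarginal Q (posSlack c v)) x ^ 2 ∂P :=
    integral_nonneg fun _ => sq_nonneg _
  have hn2 : 0 ≤ ∫ y, (ContinuousMap.const Y ε - sndMarginal P (posSlack c v)) y ^ 2 ∂Q :=
    integral_nonneg fun _ => sq_nonneg _
  rw [sqNorm] at hN
  exact ⟨v, hv.2.2.1, (sub_eq_zero.1 (eq_zero_of_integral_sq_eq_zero P (by linarith))).symm,
    (sub_eq_zero.1 (eq_zero_of_integral_sq_eq_zero Q (by linarith))).symm⟩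

end Existence

/-! ### Restriction to supports; couplings and optimality -/

section Support

variable {Z : Type*} [TopologicalSpace Z] [HereditarilyLindelofSpace Z] [MeasurableSpace Z]
  [BorelSpace Z]

/-- The restriction of a measure to its support, as a measure on the subtype. -/
noncomputable def suppMeasure (μ : Measure Z) : Measure μ.support := μ.comap Subtype.val

lemma measurableEmbedding_support (μ : Measure Z) :
    MeasurableEmbedding (Subtype.val : μ.support → Z) :=
  MeasurableEmbedding.subtype_coe Measure.isClosed_support.measurableSet

lemma map_suppMeasure (μ : Measure Z) : (suppMeasure μ).map Subtype.val = μ := by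
  rw [suppMeasure, map_comap_subtype_coe Measure.isClosed_support.measurableSet,
    Measure.restrict_eq_self_of_ae_mem (s := μ.support) Measure.support_mem_ae]

lemma suppMeasure_preimage (μ : Measure Z) (s : Set Z) :
    suppMeasure μ (Subtype.val ⁻¹' s) = μ s := by
  rw [← (measurableEmbedding_support μ).map_apply, map_suppMeasure]

instance (μ : Measure Z) [IsProbabilityMeasure μ] : IsProbabilityMeasure (suppMeasure μ) :=
  ⟨by simpa using suppMeasure_preimage μ univ⟩

instance (μ : Measure Z) : (suppMeasure μ).IsOpenPosMeasure := by
  refine ⟨fun U hU ⟨x, hx⟩ => ?_⟩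
  obtain ⟨V, hV, rfl⟩ := isOpen_induced_iff.1 hU
  rw [suppMeasure_preimage]
  exact (Measure.mem_support_iff_forall _ |>.1 x.2 V (hV.mem_nhds hx)).ne'

lemma integral_suppMeasure (μ : Measure Z) (f : Z → ℝ) :
    ∫ x, f x ∂(suppMeasure μ) = ∫ x, f x ∂μ := by
  conv_rhs => rw [← map_suppMeasure μ, (measurableEmbedding_support μ).integral_map]

lemma lintegral_suppMeasure (μ : Measure Z) (f : Z → ℝ≥0∞) :
    ∫⁻ x, f x ∂(suppMeasure μ) = ∫⁻ x, f x ∂μ := by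
  conv_rhs => rw [← map_suppMeasure μ, (measurableEmbedding_support μ).lintegral_map]

lemma memLp_suppMeasure {μ : Measure Z} {f : Z → ℝ} {p : ℝ≥0∞} :
    MemLp (fun x : μ.support => f x) p (suppMeasure μ) ↔ MemLp f p μ := by
  conv_rhs => rw [← map_suppMeasure μ, (measurableEmbedding_support μ).memLp_map_measure_iff]
  rfl

lemma ae_suppMeasure {μ : Measure Z} {p : Z → Prop} :
    (∀ᵐ x : μ.support ∂suppMeasure μ, p x) ↔ ∀ᵐ x ∂μ, p x := by
  conv_rhs => rw [← map_suppMeasure μ, (measurableEmbedding_support μ).ae_map_iff]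

lemma ae_prod_suppMeasure {Z' : Type*} [TopologicalSpace Z'] [HereditarilyLindelofSpace Z']
    [MeasurableSpace Z'] [BorelSpace Z'] {μ : Measure Z} {ν : Measure Z'} [IsProbabilityMeasure μ]
    [IsProbabilityMeasure ν] {p : Z × Z' → Prop} :
    (∀ᵐ z ∂((suppMeasure μ).prod (suppMeasure ν)), p (z.1, z.2)) ↔ ∀ᵐ z ∂(μ.prod ν), p z := by
  have h := (measurableEmbedding_support μ).prodMap (measurableEmbedding_support ν)
  conv_rhs => rw [← map_suppMeasure μ, ← map_suppMeasure ν, Measure.map_prod_map _ _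
    (measurableEmbedding_support μ).measurable (measurableEmbedding_support ν).measurable,
    h.ae_map_iff]
  rfl

lemma support_prod {Z' : Type*} [TopologicalSpace Z'] [HereditarilyLindelofSpace Z']
    [MeasurableSpace Z'] [BorelSpace Z'] (μ : Measure Z) (ν : Measure Z') [IsProbabilityMeasure μ]
    [IsProbabilityMeasure ν] : (μ.prod ν).support = μ.support ×ˢ ν.support := by
  refine Subset.antisymm (Measure.support_subset_of_isClosed
    (Measure.isClosed_support.prod Measure.isClosed_support) ?_) ?_
  · filter_upwards [Measure.quasiMeasurePreserving_fst.ae (Measure.support_mem_ae (μ := μ)),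
      Measure.quasiMeasurePreserving_snd.ae (Measure.support_mem_ae (μ := ν))] with z h1 h2
    exact ⟨h1, h2⟩
  · rintro ⟨x, y⟩ ⟨hx, hy⟩
    rw [Measure.mem_support_iff_forall] at *
    intro U hU
    obtain ⟨V, hV, W, hW, hVW⟩ := mem_nhds_prod_iff.1 hU
    refine lt_of_lt_of_le ?_ (measure_mono hVW)
    rw [Measure.prod_prod]
    exact ENNReal.mul_pos (hx V hV).ne' (hy W hW).ne'

end Support

section Couplings

variable {d : ℕ} {P Q : Measure (Rd d)} [IsProbabilityMeasure P] [IsProbabilityMeasure Q]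

lemma measurable_slack {f g : Rd d → ℝ} (hf : Measurable f) (hg : Measurable g) :
    Measurable fun z : Rd d × Rd d => slack f g z.1 z.2 := by
  unfold slack
  fun_prop

lemma lintegral_add_of_mem_couplings {π : Measure (Rd d × Rd d)} (hπ : π ∈ couplings P Q)
    {a b : Rd d → ℝ≥0∞} (ha : Measurable a) (hb : Measurable b) :
    ∫⁻ z, (a z.1 + b z.2) ∂π = ∫⁻ x, a x ∂P + ∫⁻ y, b y ∂Q := by
  rw [lintegral_add_left (by fun_prop), ← hπ.1, ← hπ.2, lintegral_map ha measurable_fst,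
    lintegral_map hb measurable_snd]

lemma integral_add_of_mem_couplings {π : Measure (Rd d × Rd d)} (hπ : π ∈ couplings P Q)
    {a b : Rd d → ℝ} (ha : Integrable a P) (hb : Integrable b Q) :
    ∫ z, (a z.1 + b z.2) ∂π = ∫ x, a x ∂P + ∫ y, b y ∂Q := by
  have ha' := ha
  have hb' := hb
  rw [← hπ.1] at ha'
  rw [← hπ.2] at hb'
  have i1 : Integrable (fun z : Rd d × Rd d => a z.1) π := ha'.comp_measurable measurable_fst
  have i2 : Integrable (fun z : Rd d × Rd d => b z.2) π := hb'.comp_measurable measurable_snd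
  rw [integral_add i1 i2]
  congr 1
  · conv_rhs => rw [← hπ.1]
    exact (integral_map measurable_fst.aemeasurable ha'.1).symm
  · conv_rhs => rw [← hπ.2]
    exact (integral_map measurable_snd.aemeasurable hb'.1).symm

lemma memLp_slack (hP : IsCompact P.support) (hQ : IsCompact Q.support) {f g : Rd d → ℝ}
    (hf : MemLp f 2 P) (hg : MemLp g 2 Q) :
    MemLp (fun z : Rd d × Rd d => slack f g z.1 z.2) 2 (P.prod Q) := by
  have hcost : MemLp (fun z : Rd d × Rd d => ‖z.1 - z.2‖ ^ 2 / 2) 2 (P.prod Q) := by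
    obtain ⟨M, hM⟩ := (hP.prod hQ).exists_bound_of_continuousOn
      (f := fun z : Rd d × Rd d => ‖z.1 - z.2‖ ^ 2 / 2) (by fun_prop)
    refine MemLp.of_bound (by fun_prop) M ?_
    filter_upwards [Measure.quasiMeasurePreserving_fst.ae (Measure.support_mem_ae (μ := P)),
      Measure.quasiMeasurePreserving_snd.ae (Measure.support_mem_ae (μ := Q))] with z h1 h2
    exact hM z ⟨h1, h2⟩
  exact ((hf.comp_fst Q).add (hg.comp_snd P)).sub hcost

lemma memLp_posSlack (hP : IsCompact P.support) (hQ : IsCompact Q.support) {f g : Rd d → ℝ}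
    (hf : MemLp f 2 P) (hg : MemLp g 2 Q) :
    MemLp (fun z : Rd d × Rd d => max (slack f g z.1 z.2) 0) 2 (P.prod Q) :=
  (memLp_slack hP hQ hf hg).pos_part

/-- The first-order condition in weak form. -/
lemma integral_posSlack_mul_add (hP : IsCompact P.support) (hQ : IsCompact Q.support)
    {ε : ℝ} (hε : 0 < ε) {π : Measure (Rd d × Rd d)} (hπ : π ∈ couplings P Q) {f g : Rd d → ℝ}
    (hfg : IsPotentials P Q ε π f g) {a b : Rd d → ℝ} (ha : MemLp a 2 P) (hb : MemLp b 2 Q) :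
    ∫ z, max (slack f g z.1 z.2) 0 * (a z.1 + b z.2) ∂(P.prod Q) =
      ε * (∫ x, a x ∂P + ∫ y, b y ∂Q) := by
  rw [← integral_add_of_mem_couplings hπ (ha.integrable one_le_two) (hb.integrable one_le_two),
    hfg.2, integral_withDensity_eq_integral_toReal_smul₀ _ (.of_forall fun z => by simp),
    ← integral_const_mul]
  · refine integral_congr_ae (.of_forall fun z => ?_)
    have : 0 ≤ 1 / ε * max (slack f g z.1 z.2) 0 := by positivity
    simp only [ENNReal.toReal_ofReal this, smul_eq_mul]
    field_simp
  · exact ((memLp_posSlack hP hQ hfg.1.1 hfg.1.2.1).1.aemeasurable.const_mul _).ennreal_ofReal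

/-- Two couplings with potentials have the same density: testing both first-order conditions with
the difference of the potentials, the monotonicity of the positive part leaves no room. -/
lemma ae_posSlack_eq (hP : IsCompact P.support) (hQ : IsCompact Q.support)
    {ε : ℝ} (hε : 0 < ε) {π π' : Measure (Rd d × Rd d)} (hπ : π ∈ couplings P Q)
    (hπ' : π' ∈ couplings P Q) {f g f' g' : Rd d → ℝ}
    (hfg : IsPotentials P Q ε π f g) (hfg' : IsPotentials P Q ε π' f' g') :
    ∀ᵐ z ∂(P.prod Q), max (slack f g z.1 z.2) 0 = max (slack f' g' z.1 z.2) 0 := by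
  have ha := hfg.1.1.sub hfg'.1.1
  have hb := hfg.1.2.1.sub hfg'.1.2.1
  have h1 := integral_posSlack_mul_add hP hQ hε hπ hfg ha hb
  have h2 := integral_posSlack_mul_add hP hQ hε hπ' hfg' ha hb
  have hw : MemLp (fun z : Rd d × Rd d => (f - f') z.1 + (g - g') z.2) 2 (P.prod Q) :=
    (ha.comp_fst Q).add (hb.comp_snd P)
  have i1 : Integrable (fun z : Rd d × Rd d =>
      max (slack f g z.1 z.2) 0 * ((f - f') z.1 + (g - g') z.2)) (P.prod Q) :=
    (memLp_posSlack hP hQ hfg.1.1 hfg.1.2.1).integrable_mul hw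
  have i2 : Integrable (fun z : Rd d × Rd d =>
      max (slack f' g' z.1 z.2) 0 * ((f - f') z.1 + (g - g') z.2)) (P.prod Q) :=
    (memLp_posSlack hP hQ hfg'.1.1 hfg'.1.2.1).integrable_mul hw
  have hw' : ∀ z : Rd d × Rd d, (f - f') z.1 + (g - g') z.2 =
      slack f g z.1 z.2 - slack f' g' z.1 z.2 := fun z => by
    simp only [slack, Pi.sub_apply]
    ring
  have h3 : ∫ z : Rd d × Rd d, (max (slack f g z.1 z.2) 0 * ((f - f') z.1 + (g - g') z.2) -
      max (slack f' g' z.1 z.2) 0 * ((f - f') z.1 + (g - g') z.2)) ∂(P.prod Q) = 0 := by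
    rw [integral_sub i1 i2, h1, h2, sub_self]
  have i3 : Integrable (fun z : Rd d × Rd d =>
      max (slack f g z.1 z.2) 0 * ((f - f') z.1 + (g - g') z.2) -
      max (slack f' g' z.1 z.2) 0 * ((f - f') z.1 + (g - g') z.2)) (P.prod Q) := i1.sub i2
  rw [integral_eq_zero_iff_of_nonneg (fun z => ?_) i3] at h3
  · filter_upwards [h3] with z hz
    simp only [hw', ← sub_mul, Pi.zero_apply, mul_eq_zero] at hz
    rcases hz with h | h
    · linarith
    · rw [sub_eq_zero.1 h]
  · simp only [Pi.zero_apply, hw', ← sub_mul]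
    exact posPart_sub_mul_sub_nonneg _ _

lemma primalObjective_withDensity (ε : ℝ) {ρ : Rd d × Rd d → ℝ≥0∞} (hρ : Measurable ρ) :
    primalObjective P Q ε ((P.prod Q).withDensity ρ) =
      ∫⁻ z, (ρ z * ENNReal.ofReal (‖z.1 - z.2‖ ^ 2 / 2) + ENNReal.ofReal (ε / 2) * ρ z ^ 2)
        ∂(P.prod Q) := by
  have h1 : ∫⁻ z, ((P.prod Q).withDensity ρ).rnDeriv (P.prod Q) z ^ 2 ∂(P.prod Q) =
      ∫⁻ z, ρ z ^ 2 ∂(P.prod Q) := by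
    refine lintegral_congr_ae ?_
    filter_upwards [Measure.rnDeriv_withDensity (P.prod Q) hρ] with z hz
    rw [hz]
  rw [primalObjective, if_pos (withDensity_absolutelyContinuous _ _), h1,
    lintegral_withDensity_eq_lintegral_mul _ hρ (by fun_prop),
    lintegral_add_left (by fun_prop), lintegral_const_mul _ (by fun_prop)]
  rfl

/-- Fenchel-Young inequality for the quadratic regularization, with a shift by `β` that makes all
terms nonnegative. -/
lemma mul_shifted_add_le {ε β a b C r : ℝ} (hε : 0 < ε) (hr : 0 ≤ r) :
    r * ((a + β) + (b + β)) ≤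
      r * C + ε / 2 * r ^ 2 + (1 / (2 * ε) * max (a + b - C) 0 ^ 2 + 2 * β * r) := by
  have h : r * (a + b - C) ≤ r * max (a + b - C) 0 :=
    mul_le_mul_of_nonneg_left (le_max_left _ _) hr
  have h2 : ε / 2 * r ^ 2 + 1 / (2 * ε) * max (a + b - C) 0 ^ 2 - r * max (a + b - C) 0 =
      1 / (2 * ε) * (ε * r - max (a + b - C) 0) ^ 2 := by
    field_simp
    ring
  have h3 : 0 ≤ 1 / (2 * ε) * (ε * r - max (a + b - C) 0) ^ 2 := by positivity
  linarith

lemma mul_shifted_add_eq {ε β a b C r : ℝ} (hε : 0 < ε) (hr : r = 1 / ε * max (a + b - C) 0) :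
    r * ((a + β) + (b + β)) =
      r * C + ε / 2 * r ^ 2 + (1 / (2 * ε) * max (a + b - C) 0 ^ 2 + 2 * β * r) := by
  subst hr
  rcases le_total (a + b - C) 0 with h | h
  · simp [max_eq_right h]
  · rw [max_eq_left h]
    field_simp
    ring

/-- **Weak duality and optimality**: a coupling whose density is the positive part of a bounded
slack, divided by `ε`, minimizes the primal objective. -/
theorem isOptimalCoupling_of_posSlack {ε β : ℝ} (hε : 0 < ε) (hβ : 0 ≤ β) {f g : Rd d → ℝ}
    (hf : Measurable f) (hg : Measurable g) (hfβ : ∀ x ∈ P.support, |f x| ≤ β)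
    (hgβ : ∀ y ∈ Q.support, |g y| ≤ β)
    (hπ : (P.prod Q).withDensity (fun z => ENNReal.ofReal (1 / ε * max (slack f g z.1 z.2) 0)) ∈
      couplings P Q) :
    IsOptimalCoupling P Q ε
      ((P.prod Q).withDensity fun z => ENNReal.ofReal (1 / ε * max (slack f g z.1 z.2) 0)) := by
  have hs := measurable_slack hf hg
  have hsupp : ∀ᵐ z ∂(P.prod Q), z.1 ∈ P.support ∧ z.2 ∈ Q.support := by
    filter_upwards [Measure.quasiMeasurePreserving_fst.ae (Measure.support_mem_ae (μ := P)),
      Measure.quasiMeasurePreserving_snd.ae (Measure.support_mem_ae (μ := Q))] with z h1 h2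
    exact ⟨h1, h2⟩
  set K : ℝ≥0∞ := ∫⁻ z, ENNReal.ofReal (1 / (2 * ε) * max (slack f g z.1 z.2) 0 ^ 2) ∂(P.prod Q)
    with hKdef
  have hK : K ≠ ∞ := by
    refine ne_of_lt (lt_of_le_of_lt (lintegral_mono_ae (g := fun _ =>
      ENNReal.ofReal (1 / (2 * ε) * (2 * β) ^ 2)) ?_) (by simp))
    filter_upwards [hsupp] with z hz
    have h1 := hfβ z.1 hz.1
    have h2 := hgβ z.2 hz.2
    rw [abs_le] at h1 h2
    have h3 : max (slack f g z.1 z.2) 0 ≤ 2 * β := by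
      refine max_le ?_ (by positivity)
      have : 0 ≤ ‖z.1 - z.2‖ ^ 2 / 2 := by positivity
      rw [slack]
      linarith
    gcongr
  -- the value of the left-hand side of the Fenchel-Young inequality is the same for all couplings
  have hconst : ∀ ρ : Rd d × Rd d → ℝ≥0∞, Measurable ρ →
      (P.prod Q).withDensity ρ ∈ couplings P Q →
      ∫⁻ z, ρ z * (ENNReal.ofReal (f z.1 + β) + ENNReal.ofReal (g z.2 + β)) ∂(P.prod Q) =
        ∫⁻ x, ENNReal.ofReal (f x + β) ∂P + ∫⁻ y, ENNReal.ofReal (g y + β) ∂Q := by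
    intro ρ hρ hmem
    rw [← lintegral_add_of_mem_couplings hmem (by fun_prop) (by fun_prop),
      lintegral_withDensity_eq_lintegral_mul _ hρ (by fun_prop)]
    rfl
  have hmass : ∀ ρ : Rd d × Rd d → ℝ≥0∞, Measurable ρ →
      (P.prod Q).withDensity ρ ∈ couplings P Q → ∫⁻ z, ρ z ∂(P.prod Q) = 1 := by
    intro ρ hρ hmem
    have h := measure_univ (μ := P)
    rw [← hmem.1, Measure.map_apply measurable_fst .univ, preimage_univ,
      withDensity_apply _ .univ, Measure.restrict_univ] at h
    exact h
  have hsplit : ∀ ρ : Rd d × Rd d → ℝ≥0∞, Measurable ρ →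
      (P.prod Q).withDensity ρ ∈ couplings P Q →
      ∫⁻ z, ((ρ z * ENNReal.ofReal (‖z.1 - z.2‖ ^ 2 / 2) + ENNReal.ofReal (ε / 2) * ρ z ^ 2) +
        (ENNReal.ofReal (1 / (2 * ε) * max (slack f g z.1 z.2) 0 ^ 2) +
          ENNReal.ofReal (2 * β) * ρ z)) ∂(P.prod Q) =
      primalObjective P Q ε ((P.prod Q).withDensity ρ) + (K + ENNReal.ofReal (2 * β)) := by
    intro ρ hρ hmem
    rw [lintegral_add_left (by fun_prop), ← primalObjective_withDensity ε hρ,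
      lintegral_add_left (by fun_prop), lintegral_const_mul _ hρ, hmass ρ hρ hmem, mul_one]
  refine ⟨hπ, fun π' hπ' => ?_⟩
  by_cases hac : π' ≪ P.prod Q
  swap
  · rw [primalObjective, primalObjective, if_neg hac, add_top]
    exact le_top
  have : IsProbabilityMeasure π' := ⟨by
    have h := measure_univ (μ := P)
    rwa [← hπ'.1, Measure.map_apply measurable_fst .univ, preimage_univ] at h⟩
  have hζ := Measure.measurable_rnDeriv π' (P.prod Q)
  have hπ'eq : (P.prod Q).withDensity (π'.rnDeriv (P.prod Q)) = π' :=
    Measure.withDensity_rnDeriv_eq _ _ hac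
  have hπ'mem : (P.prod Q).withDensity (π'.rnDeriv (P.prod Q)) ∈ couplings P Q := by
    rwa [hπ'eq]
  rw [← hπ'eq, ← ENNReal.add_le_add_iff_right (a := K + ENNReal.ofReal (2 * β)) (by finiteness),
    ← hsplit _ (by fun_prop) hπ, ← hsplit _ hζ hπ'mem]
  calc _ = ∫⁻ z, ENNReal.ofReal (1 / ε * max (slack f g z.1 z.2) 0) *
        (ENNReal.ofReal (f z.1 + β) + ENNReal.ofReal (g z.2 + β)) ∂(P.prod Q) := by
        refine lintegral_congr_ae ?_
        filter_upwards [hsupp] with z hz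
        have h1 := hfβ z.1 hz.1
        have h2 := hgβ z.2 hz.2
        rw [abs_le] at h1 h2
        have hr : 0 ≤ 1 / ε * max (slack f g z.1 z.2) 0 := by positivity
        rw [← ENNReal.ofReal_add (by linarith) (by linarith), ← ENNReal.ofReal_mul hr,
          ← ENNReal.ofReal_pow hr, ← ENNReal.ofReal_mul hr, ← ENNReal.ofReal_mul (by positivity),
          ← ENNReal.ofReal_mul (by positivity), ← ENNReal.ofReal_add (by positivity)
          (by positivity), ← ENNReal.ofReal_add (by positivity) (by positivity),
          ← ENNReal.ofReal_add (by positivity) (by positivity)]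
        exact congrArg _ (mul_shifted_add_eq hε rfl).symm
    _ = ∫⁻ z, π'.rnDeriv (P.prod Q) z *
        (ENNReal.ofReal (f z.1 + β) + ENNReal.ofReal (g z.2 + β)) ∂(P.prod Q) := by
        rw [hconst _ (by fun_prop) hπ, hconst _ hζ hπ'mem]
    _ ≤ _ := by
        refine lintegral_mono_ae ?_
        filter_upwards [hsupp, π'.rnDeriv_ne_top (P.prod Q)] with z hz htop
        have h1 := hfβ z.1 hz.1
        have h2 := hgβ z.2 hz.2
        rw [abs_le] at h1 h2
        obtain ⟨r, hr0, hr⟩ : ∃ r : ℝ, 0 ≤ r ∧ π'.rnDeriv (P.prod Q) z = ENNReal.ofReal r :=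
          ⟨_, ENNReal.toReal_nonneg, (ENNReal.ofReal_toReal htop).symm⟩
        rw [hr, ← ENNReal.ofReal_add (by linarith) (by linarith), ← ENNReal.ofReal_mul hr0,
          ← ENNReal.ofReal_pow hr0, ← ENNReal.ofReal_mul hr0, ← ENNReal.ofReal_mul (by positivity),
          ← ENNReal.ofReal_mul (by positivity), ← ENNReal.ofReal_add (by positivity)
          (by positivity), ← ENNReal.ofReal_add (by positivity) (by positivity),
          ← ENNReal.ofReal_add (by positivity) (by positivity)]
        exact ENNReal.ofReal_le_ofReal (mul_shifted_add_le hε hr0)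

end Couplings

/-! ### Transport to the supports -/

section Transport

variable {d : ℕ} {P Q : Measure (Rd d)} [IsProbabilityMeasure P] [IsProbabilityMeasure Q]

/-- The quadratic cost on `S × T`. -/
noncomputable def quadCost (S T : Set (Rd d)) : C(S × T, ℝ) where
  toFun z := ‖(z.1 : Rd d) - z.2‖ ^ 2 / 2

lemma quadCost_apply (S T : Set (Rd d)) (z : S × T) :
    quadCost S T z = ‖(z.1 : Rd d) - z.2‖ ^ 2 / 2 := rfl

/-- The pair `(f, g)` of functions on `ℝ^d` extends the pair `u` of continuous functions on the
supports of `P` and `Q`. -/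
def Extends (u : C(P.support, ℝ) × C(Q.support, ℝ)) (f g : Rd d → ℝ) : Prop :=
  (∀ x : P.support, f x = u.1 x) ∧ ∀ y : Q.support, g y = u.2 y

lemma Extends.slack_eq {u : C(P.support, ℝ) × C(Q.support, ℝ)} {f g : Rd d → ℝ}
    (h : Extends u f g) (x : P.support) (y : Q.support) :
    slack f g x y = u.1 x + u.2 y - quadCost P.support Q.support (x, y) := by
  rw [slack, h.1, h.2, quadCost_apply]

variable [CompactSpace P.support] [CompactSpace Q.support]

lemma Extends.integral_fst {u : C(P.support, ℝ) × C(Q.support, ℝ)} {f g : Rd d → ℝ}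
    (h : Extends u f g) : ∫ x, f x ∂P = ∫ x, u.1 x ∂(suppMeasure P) := by
  rw [← integral_suppMeasure]
  simp only [h.1]

lemma Extends.integral_snd {u : C(P.support, ℝ) × C(Q.support, ℝ)} {f g : Rd d → ℝ}
    (h : Extends u f g) : ∫ y, g y ∂Q = ∫ y, u.2 y ∂(suppMeasure Q) := by
  rw [← integral_suppMeasure]
  simp only [h.2]

lemma Extends.memLp {u : C(P.support, ℝ) × C(Q.support, ℝ)} {f g : Rd d → ℝ}
    (h : Extends u f g) : MemLp f 2 P ∧ MemLp g 2 Q := by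
  refine ⟨memLp_suppMeasure.1 ?_, memLp_suppMeasure.1 ?_⟩
  · simp only [h.1]
    exact u.1.continuous.memLp_of_compactSpace 2
  · simp only [h.2]
    exact u.2.continuous.memLp_of_compactSpace 2

/-- On the supports, the iterates are those of the gradient step with `τ = η / ε`. -/
lemma Extends.iterates {u : C(P.support, ℝ) × C(Q.support, ℝ)} {f g : Rd d → ℝ}
    (h : Extends u f g) {ε : ℝ} (hε : ε ≠ 0) (η : ℝ) (n : ℕ) :
    Extends ((gradStep (suppMeasure P) (suppMeasure Q) (quadCost P.support Q.support) ε (η / ε))^[n]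
      u) (iterates P Q ε η (f, g) n).1 (iterates P Q ε η (f, g) n).2 := by
  induction n with
  | zero => exact h
  | succ n ih =>
    rw [Function.iterate_succ_apply']
    refine ⟨fun x => ?_, fun y => ?_⟩
    · simp only [QOT.iterates, dualGradient, Prod.fst_add, Prod.smul_fst, Pi.add_apply,
        Pi.smul_apply, smul_eq_mul, gradStep, ContinuousMap.add_apply, ContinuousMap.smul_apply,
        ContinuousMap.sub_apply, ContinuousMap.const_apply, fstMarginal_apply, posSlack_apply]
      rw [← integral_suppMeasure Q]
      simp only [ih.slack_eq, ih.1]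
      field_simp
    · simp only [QOT.iterates, dualGradient, Prod.snd_add, Prod.smul_snd, Pi.add_apply,
        Pi.smul_apply, smul_eq_mul, gradStep, ContinuousMap.add_apply, ContinuousMap.smul_apply,
        ContinuousMap.sub_apply, ContinuousMap.const_apply, sndMarginal_apply, posSlack_apply]
      rw [← integral_suppMeasure P]
      simp only [ih.slack_eq, ih.2]
      field_simp

lemma lintegral_ofReal_eq_one {α : Type*} [MeasurableSpace α] {μ : Measure α} {F : α → ℝ} {ε : ℝ}
    (hε : 0 < ε) (hF : Integrable F μ) (hF0 : ∀ x, 0 ≤ F x) (h : ∫ x, F x ∂μ = ε) :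
    ∫⁻ x, ENNReal.ofReal (1 / ε * F x) ∂μ = 1 := by
  rw [← ofReal_integral_eq_lintegral_ofReal (hF.const_mul _)
    (.of_forall fun x => mul_nonneg (by positivity) (hF0 x)), integral_const_mul, h,
    one_div_mul_cancel hε.ne', ENNReal.ofReal_one]

/-- A zero of the gradient yields a coupling. -/
lemma Extends.mem_couplings {v : C(P.support, ℝ) × C(Q.support, ℝ)} {f g : Rd d → ℝ}
    (h : Extends v f g) (hf : Measurable f) (hg : Measurable g) {ε : ℝ} (hε : 0 < ε)
    (hv₁ : fstMarginal (suppMeasure Q) (posSlack (quadCost P.support Q.support) v) =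
      ContinuousMap.const _ ε)
    (hv₂ : sndMarginal (suppMeasure P) (posSlack (quadCost P.support Q.support) v) =
      ContinuousMap.const _ ε) :
    (P.prod Q).withDensity (fun z => ENNReal.ofReal (1 / ε * max (slack f g z.1 z.2) 0)) ∈
      couplings P Q := by
  have hs := measurable_slack hf hg
  have hρ : Measurable fun z : Rd d × Rd d =>
    ENNReal.ofReal (1 / ε * max (slack f g z.1 z.2) 0) := by fun_prop
  have h1 : ∀ᵐ x ∂P, ∫⁻ y, ENNReal.ofReal (1 / ε * max (slack f g x y) 0) ∂Q = 1 := by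
    rw [← ae_suppMeasure]
    refine .of_forall fun x => ?_
    rw [← lintegral_suppMeasure]
    simp only [h.slack_eq]
    exact lintegral_ofReal_eq_one hε (Continuous.integrable_of_compactSpace (by fun_prop))
      (fun _ => le_max_right _ _) (DFunLike.congr_fun hv₁ x)
  have h2 : ∀ᵐ y ∂Q, ∫⁻ x, ENNReal.ofReal (1 / ε * max (slack f g x y) 0) ∂P = 1 := by
    rw [← ae_suppMeasure]
    refine .of_forall fun y => ?_
    rw [← lintegral_suppMeasure]
    simp only [h.slack_eq]
    exact lintegral_ofReal_eq_one hε (Continuous.integrable_of_compactSpace (by fun_prop))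
      (fun _ => le_max_right _ _) (DFunLike.congr_fun hv₂ y)
  constructor
  · ext s hs
    rw [Measure.map_apply measurable_fst hs, ← prod_univ, withDensity_apply _ (hs.prod .univ),
      setLIntegral_prod _ hρ.aemeasurable, Measure.restrict_univ,
      lintegral_congr_ae (ae_restrict_of_ae h1), setLIntegral_one]
  · ext s hs
    rw [Measure.map_apply measurable_snd hs, ← univ_prod, withDensity_apply _ (.prod .univ hs),
      setLIntegral_prod_symm _ hρ.aemeasurable, Measure.restrict_univ,
      lintegral_congr_ae (ae_restrict_of_ae h2), setLIntegral_one]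

lemma exists_measurable_extends (v : C(P.support, ℝ) × C(Q.support, ℝ)) :
    ∃ f g : Rd d → ℝ, Measurable f ∧ Measurable g ∧ Extends v f g := by
  obtain ⟨f, hf, hfv⟩ := (measurableEmbedding_support P).exists_measurable_extend
    v.1.continuous.measurable fun _ => inferInstance
  obtain ⟨g, hg, hgv⟩ := (measurableEmbedding_support Q).exists_measurable_extend
    v.2.continuous.measurable fun _ => inferInstance
  exact ⟨f, g, hf, hg, congrFun hfv, congrFun hgv⟩

/-- Existence of an optimal coupling with potentials that are continuous on the supports. -/
lemma exists_isOptimalCoupling_isPotentials (P Q : Measure (Rd d)) [IsProbabilityMeasure P]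
    [IsProbabilityMeasure Q] [CompactSpace P.support] [CompactSpace Q.support] {ε : ℝ}
    (hε : 0 < ε) :
    ∃ (v : C(P.support, ℝ) × C(Q.support, ℝ)) (π : Measure (Rd d × Rd d)) (f g : Rd d → ℝ),
      Extends v f g ∧ IsOptimalCoupling P Q ε π ∧ IsPotentials P Q ε π f g ∧
      ∫ x, v.1 x ∂(suppMeasure P) = ∫ y, v.2 y ∂(suppMeasure Q) ∧
      fstMarginal (suppMeasure Q) (posSlack (quadCost P.support Q.support) v) =
        ContinuousMap.const _ ε ∧
      sndMarginal (suppMeasure P) (posSlack (quadCost P.support Q.support) v) =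
        ContinuousMap.const _ ε := by
  obtain ⟨v, hmean, hv₁, hv₂⟩ := exists_marginal_posSlack_eq (suppMeasure P) (suppMeasure Q)
    (quadCost P.support Q.support) hε.le
  obtain ⟨f, g, hf, hg, hext⟩ := exists_measurable_extends v
  refine ⟨v, _, f, g, hext, isOptimalCoupling_of_posSlack (β := ‖v.1‖ + ‖v.2‖) hε (by positivity)
    hf hg (fun x hx => ?_) (fun y hy => ?_) (hext.mem_couplings hf hg hε hv₁ hv₂),
    ⟨⟨hext.memLp.1, hext.memLp.2, ?_⟩, rfl⟩, hmean, hv₁, hv₂⟩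
  · rw [hext.1 ⟨x, hx⟩]
    exact (v.1.norm_coe_le_norm _).trans (le_add_of_nonneg_right (norm_nonneg _))
  · rw [hext.2 ⟨y, hy⟩]
    exact (v.2.norm_coe_le_norm _).trans (le_add_of_nonneg_left (norm_nonneg _))
  · rw [hext.integral_fst, hext.integral_snd, hmean]

/-- **Uniqueness of potentials**: square-integrable potentials of any coupling agree almost
everywhere with a continuous zero of the gradient, by the spectral gap. -/
lemma IsPotentials.ae_eq [ConnectedSpace Q.support] {v : C(P.support, ℝ) × C(Q.support, ℝ)}
    {ε : ℝ} (hε : 0 < ε)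
    (hv₁ : fstMarginal (suppMeasure Q) (posSlack (quadCost P.support Q.support) v) =
      ContinuousMap.const _ ε)
    (hv₂ : sndMarginal (suppMeasure P) (posSlack (quadCost P.support Q.support) v) =
      ContinuousMap.const _ ε)
    {π π' : Measure (Rd d × Rd d)} {f g f' g' : Rd d → ℝ} (hext : Extends v f g)
    (hπ : π ∈ couplings P Q) (hπ' : π' ∈ couplings P Q) (hfg : IsPotentials P Q ε π f g)
    (hfg' : IsPotentials P Q ε π' f' g') : f' =ᵐ[P] f ∧ g' =ᵐ[Q] g := by
  have hae := ae_posSlack_eq (isCompact_iff_compactSpace.2 inferInstance)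
    (isCompact_iff_compactSpace.2 inferInstance) hε hπ hπ' hfg hfg'
  rw [← ae_prod_suppMeasure] at hae
  obtain ⟨C, hC, hgap⟩ := exists_integral_sq_add_integral_sq_le (suppMeasure P) (suppMeasure Q)
    (ω := posSlack (quadCost P.support Q.support) v) (by fun_prop) (fun _ => le_max_right _ _)
    (fun y => by
      obtain ⟨x, hx⟩ := exists_fst_slack_pos (suppMeasure P) hε hv₂ y
      exact ⟨x, lt_max_of_lt_left hx⟩)
    (fun x => by
      obtain ⟨y, hy⟩ := exists_snd_slack_pos (suppMeasure Q) hε hv₁ x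
      exact ⟨y, lt_max_of_lt_left hy⟩)
  have ha := memLp_suppMeasure.2 (hfg'.1.1.sub hfg.1.1)
  have hb := memLp_suppMeasure.2 (hfg'.1.2.1.sub hfg.1.2.1)
  have key := hgap _ _ ha hb (by
    rw [integral_suppMeasure P (f' - f), integral_suppMeasure Q (g' - g),
      integral_sub' (hfg'.1.1.integrable one_le_two) (hfg.1.1.integrable one_le_two),
      integral_sub' (hfg'.1.2.1.integrable one_le_two) (hfg.1.2.1.integrable one_le_two),
      hfg.1.2.2, hfg'.1.2.2])
  have hzero : ∫ z : P.support × Q.support, posSlack (quadCost P.support Q.support) v z *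
      ((f' - f) z.1 + (g' - g) z.2) ^ 2 ∂((suppMeasure P).prod (suppMeasure Q)) = 0 := by
    refine integral_eq_zero_of_ae ?_
    filter_upwards [hae] with z hz
    simp only [Pi.zero_apply, mul_eq_zero]
    rw [posSlack_apply, ← hext.slack_eq]
    rcases le_or_gt (slack f g z.1 z.2) 0 with h | h
    · exact .inl (max_eq_right h)
    · right
      have h' : max (slack f g z.1 z.2) 0 = slack f' g' z.1 z.2 := by
        rcases le_or_gt (slack f' g' z.1 z.2) 0 with h'' | h''
        · rw [max_eq_left h.le, max_eq_right h''] at hz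
          exact absurd hz h.ne'
        · rw [hz, max_eq_left h''.le]
      rw [max_eq_left h.le] at h'
      simp only [slack] at h'
      simp only [Pi.sub_apply]
      rw [show f' z.1 - f z.1 + (g' z.2 - g z.2) = 0 by linarith, zero_pow two_ne_zero]
  rw [hzero, mul_zero] at key
  have n1 : 0 ≤ ∫ x : P.support, (f' - f) x ^ 2 ∂(suppMeasure P) :=
    integral_nonneg fun _ => sq_nonneg _
  have n2 : 0 ≤ ∫ y : Q.support, (g' - g) y ^ 2 ∂(suppMeasure Q) :=
    integral_nonneg fun _ => sq_nonneg _
  have z1 : ∫ x : P.support, (f' - f) x ^ 2 ∂(suppMeasure P) = 0 := by linarith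
  have z2 : ∫ y : Q.support, (g' - g) y ^ 2 ∂(suppMeasure Q) = 0 := by linarith
  rw [integral_eq_zero_iff_of_nonneg (fun _ => sq_nonneg _) ha.integrable_sq] at z1
  rw [integral_eq_zero_iff_of_nonneg (fun _ => sq_nonneg _) hb.integrable_sq] at z2
  constructor
  · refine ae_suppMeasure.1 ?_
    filter_upwards [z1] with x hx
    simpa [sub_eq_zero] using hx
  · refine ae_suppMeasure.1 ?_
    filter_upwards [z2] with y hy
    simpa [sub_eq_zero] using hy

/-- If the slack of a zero of the gradient is nonnegative everywhere, it is an affine function of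
`y` for fixed `x`, because the quadratic terms cancel. Hence it vanishes on a `Q`-null set only. -/
lemma suppMeasure_slack_eq_zero {v : C(P.support, ℝ) × C(Q.support, ℝ)} {ε : ℝ} (hε : 0 < ε)
    (hv₁ : fstMarginal (suppMeasure Q) (posSlack (quadCost P.support Q.support) v) =
      ContinuousMap.const _ ε)
    (hv₂ : sndMarginal (suppMeasure P) (posSlack (quadCost P.support Q.support) v) =
      ContinuousMap.const _ ε)
    (hQ : ∀ C : Set (Rd d), Convex ℝ C → Q (frontier C) = 0)
    (hnn : ∀ z, 0 ≤ v.1 z.1 + v.2 z.2 - quadCost P.support Q.support z) (x : P.support) :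
    suppMeasure Q {y | v.1 x + v.2 y - quadCost P.support Q.support (x, y) = 0} = 0 := by
  set m : Rd d := ∫ x' : P.support, (x' : Rd d) ∂(suppMeasure P) with hm
  have hmint : Integrable (fun x' : P.support => (x' : Rd d)) (suppMeasure P) :=
    continuous_subtype_val.integrable_of_hasCompactSupport (HasCompactSupport.of_compactSpace _)
  obtain ⟨K, hK⟩ : ∃ K : ℝ, ∀ y : Q.support,
      v.1 x + v.2 y - quadCost P.support Q.support (x, y) =
        K + inner ℝ ((x : Rd d) - m) (y : Rd d) := by
    refine ⟨v.1 x + ε - ∫ x', v.1 x' ∂(suppMeasure P) +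
      ∫ x' : P.support, ‖(x' : Rd d)‖ ^ 2 / 2 ∂(suppMeasure P) - ‖(x : Rd d)‖ ^ 2 / 2,
      fun y => ?_⟩
    have h := DFunLike.congr_fun hv₂ y
    have hmax : ∀ x' : P.support, max (v.1 x' + v.2 y - quadCost P.support Q.support (x', y)) 0 =
        v.1 x' + v.2 y - quadCost P.support Q.support (x', y) := fun x' =>
      max_eq_left (hnn (x', y))
    simp only [sndMarginal_apply, posSlack_apply, hmax, ContinuousMap.const_apply] at h
    have he : ∀ x' : P.support, v.1 x' + v.2 y - quadCost P.support Q.support (x', y) =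
        (v.1 x' - ‖(x' : Rd d)‖ ^ 2 / 2) + inner ℝ (y : Rd d) (x' : Rd d) +
          (v.2 y - ‖(y : Rd d)‖ ^ 2 / 2) := fun x' => by
      rw [quadCost_apply, norm_sub_sq_real, real_inner_comm]
      ring
    simp only [he] at h
    rw [integral_add (Continuous.integrable_of_compactSpace (by fun_prop)) (integrable_const _),
      integral_add (Continuous.integrable_of_compactSpace (by fun_prop))
      (Continuous.integrable_of_compactSpace (by fun_prop)),
      integral_sub (Continuous.integrable_of_compactSpace (by fun_prop))
      (Continuous.integrable_of_compactSpace (by fun_prop)), integral_inner hmint, ← hm] at h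
    simp only [integral_const, probReal_univ, one_smul] at h
    rw [quadCost_apply, norm_sub_sq_real, inner_sub_left, real_inner_comm (y : Rd d) m]
    linarith
  rcases eq_or_ne (x : Rd d) m with hxm | hxm
  · have hK0 : K ≠ 0 := by
      rintro rfl
      obtain ⟨y, hy⟩ := exists_snd_slack_pos (suppMeasure Q) hε hv₁ x
      rw [hK, hxm, sub_self, inner_zero_left, add_zero] at hy
      exact lt_irrefl _ hy
    simp [hK, hxm, hK0]
  · have hclosed : IsClosed {y : Rd d | K + inner ℝ ((x : Rd d) - m) y = 0} :=
      isClosed_eq (by fun_prop) continuous_const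
    have hconv : Convex ℝ {y : Rd d | K + inner ℝ ((x : Rd d) - m) y = 0} := by
      intro y hy z hz a b ha hb hab
      simp only [mem_ofPred_eq, inner_add_right, inner_smul_right] at *
      linear_combination a * hy + b * hz - K * hab
    have hint : interior {y : Rd d | K + inner ℝ ((x : Rd d) - m) y = 0} = ∅ := by
      by_contra hne
      obtain ⟨y, hy⟩ := nonempty_iff_ne_empty.2 hne
      -- moving from an interior point in the normal direction leaves the hyperplane
      have hcont : Tendsto (fun t : ℝ => y + t • ((x : Rd d) - m)) (𝓝[≠] 0) (𝓝 y) := by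
        have : Continuous fun t : ℝ => y + t • ((x : Rd d) - m) := by fun_prop
        simpa using (this.tendsto 0).mono_left nhdsWithin_le_nhds
      obtain ⟨t, ht, ht0⟩ := ((hcont.eventually (mem_interior_iff_mem_nhds.1 hy)).and
        self_mem_nhdsWithin).exists
      have hy' := interior_subset hy
      simp only [mem_ofPred_eq] at hy' ht
      have ht' : K + inner ℝ ((x : Rd d) - m) (y + t • ((x : Rd d) - m)) = 0 := ht
      rw [inner_add_right, inner_smul_right, ← add_assoc, hy', zero_add, mul_eq_zero,
        inner_self_eq_zero, sub_eq_zero] at ht'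
      exact ht'.elim ht0 hxm
    have h0 := hQ _ hconv
    rw [hclosed.frontier_eq, hint, sdiff_empty, ← suppMeasure_preimage] at h0
    simpa [hK] using h0

/-- If the optimal coupling does not have full support, its slack is negative somewhere. -/
lemma exists_slack_neg {v : C(P.support, ℝ) × C(Q.support, ℝ)} {ε : ℝ} (hε : 0 < ε)
    (hv₁ : fstMarginal (suppMeasure Q) (posSlack (quadCost P.support Q.support) v) =
      ContinuousMap.const _ ε)
    (hv₂ : sndMarginal (suppMeasure P) (posSlack (quadCost P.support Q.support) v) =
      ContinuousMap.const _ ε)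
    (hQ : ∀ C : Set (Rd d), Convex ℝ C → Q (frontier C) = 0)
    {π : Measure (Rd d × Rd d)} {f g f' g' : Rd d → ℝ} (hext : Extends v f g)
    (hfg' : IsPotentials P Q ε π f' g') (hf : f' =ᵐ[P] f) (hg : g' =ᵐ[Q] g)
    (hsupp : π.support ≠ P.support ×ˢ Q.support) :
    ∃ z, v.1 z.1 + v.2 z.2 - quadCost P.support Q.support z < 0 := by
  by_contra! hnn
  refine hsupp ?_
  have hpos : ∀ᵐ z ∂(P.prod Q), 0 < slack f g z.1 z.2 := by
    rw [← ae_prod_suppMeasure]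
    simp only [hext.slack_eq]
    have hcl : MeasurableSet {z : P.support × Q.support |
        v.1 z.1 + v.2 z.2 - quadCost P.support Q.support z = 0} :=
      (isClosed_eq (by fun_prop) continuous_const).measurableSet
    have h0 : ((suppMeasure P).prod (suppMeasure Q)) {z : P.support × Q.support |
        v.1 z.1 + v.2 z.2 - quadCost P.support Q.support z = 0} = 0 :=
      (Measure.measure_prod_null hcl).2 (.of_forall fun x =>
        suppMeasure_slack_eq_zero hε hv₁ hv₂ hQ hnn x)
    filter_upwards [measure_eq_zero_iff_ae_notMem.1 h0] with z hz
    exact lt_of_le_of_ne (hnn z) (Ne.symm hz)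
  have hac : P.prod Q ≪ π := by
    rw [hfg'.2]
    have hmeas : AEMeasurable (fun z : Rd d × Rd d =>
        ENNReal.ofReal (1 / ε * max (slack f' g' z.1 z.2) 0)) (P.prod Q) :=
      ((memLp_posSlack (isCompact_iff_compactSpace.2 inferInstance)
        (isCompact_iff_compactSpace.2 inferInstance) hfg'.1.1
        hfg'.1.2.1).1.aemeasurable.const_mul _).ennreal_ofReal
    refine withDensity_absolutelyContinuous' hmeas ?_
    filter_upwards [hpos, Measure.quasiMeasurePreserving_fst.ae_eq_comp hf,
      Measure.quasiMeasurePreserving_snd.ae_eq_comp hg] with z hz h1 h2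
    simp only [Function.comp_apply] at h1 h2
    have : slack f' g' z.1 z.2 = slack f g z.1 z.2 := by rw [slack, slack, h1, h2]
    rw [this, ne_eq, ENNReal.ofReal_eq_zero, not_le]
    have := lt_max_of_lt_left (c := 0) hz
    positivity
  have hac' : π ≪ P.prod Q := by
    rw [hfg'.2]
    exact withDensity_absolutelyContinuous _ _
  rw [← support_prod]
  exact Subset.antisymm hac'.support_mono hac.support_mono

lemma eLpNorm_two_sq_eq_ofReal {α : Type*} [MeasurableSpace α] {μ : Measure α} {h : α → ℝ}
    (hh : MemLp h 2 μ) : eLpNorm h 2 μ ^ 2 = ENNReal.ofReal (∫ x, h x ^ 2 ∂μ) := by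
  rw [ofReal_integral_eq_lintegral_ofReal hh.integrable_sq (.of_forall fun _ => sq_nonneg _)]
  have := eLpNorm_nnreal_pow_eq_lintegral (f := h) (μ := μ) (p := 2) (by norm_num)
  simp only [← enorm_sq_eq_ofReal]
  simpa using this

/-- The norm of `L²_⊕` is computed on the supports. -/
lemma Extends.normL2Oplus_sub_eq {u v : C(P.support, ℝ) × C(Q.support, ℝ)}
    {a b f g f' g' : Rd d → ℝ}
    (hu : Extends u a b) (hv : Extends v f g) (hf : f' =ᵐ[P] f) (hg : g' =ᵐ[Q] g) :
    normL2Oplus P Q (a - f') (b - g') = ENNReal.ofReal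
      (sqNorm (suppMeasure P) (suppMeasure Q) ⇑(u.1 - v.1) ⇑(u.2 - v.2)) ^ (1 / 2 : ℝ) := by
  have h1 : a - f' =ᵐ[P] a - f := hf.mono fun x hx => by simp [hx]
  have h2 : b - g' =ᵐ[Q] b - g := hg.mono fun x hx => by simp [hx]
  have e : Extends (u - v) (a - f) (b - g) :=
    ⟨fun x => by simp [hu.1, hv.1], fun y => by simp [hu.2, hv.2]⟩
  rw [normL2Oplus, eLpNorm_congr_ae h1, eLpNorm_congr_ae h2, eLpNorm_two_sq_eq_ofReal e.memLp.1,
    eLpNorm_two_sq_eq_ofReal e.memLp.2, ← ENNReal.ofReal_add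
    (integral_nonneg fun _ => sq_nonneg _) (integral_nonneg fun _ => sq_nonneg _),
    ← integral_suppMeasure P, ← integral_suppMeasure Q]
  simp only [e.1, e.2]
  rfl

/-- A geometric rate for the squares of a sequence gives a rate without constant from some index
on, at the price of a larger ratio. -/
lemma exists_rpow_half_le_pow {a : ℕ → ℝ} {ρ : ℝ} (hρ0 : 0 < ρ) (hρ1 : ρ < 1)
    (ha : ∀ n, a (n + 1) ≤ ρ * a n) :
    ∃ (δ : ℝ) (n₀ : ℕ), 0 < δ ∧ δ < 1 ∧ ∀ n, n₀ ≤ n →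
      ENNReal.ofReal (a n) ^ (1 / 2 : ℝ) ≤ ENNReal.ofReal (δ ^ n) := by
  have hpow : ∀ n, a n ≤ ρ ^ n * a 0 := fun n => by
    induction n with
    | zero => simp
    | succ n ih =>
      refine (ha n).trans ((mul_le_mul_of_nonneg_left ih hρ0.le).trans (le_of_eq ?_))
      ring
  set r := √ρ
  have hr0 : 0 < r := Real.sqrt_pos.2 hρ0
  have hr1 : r < 1 := (Real.sqrt_lt' one_pos).2 (by simpa using hρ1)
  have hrr : r * r = ρ := Real.mul_self_sqrt hρ0.le
  have hδ0 : 0 < √r := Real.sqrt_pos.2 hr0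
  have hlim : Tendsto (fun n => r ^ n * a 0) atTop (𝓝 0) := by
    simpa using (tendsto_pow_atTop_nhds_zero_of_lt_one hr0.le hr1).mul_const (a 0)
  obtain ⟨n₀, hn₀⟩ := eventually_atTop.1 (hlim.eventually (ge_mem_nhds zero_lt_one))
  refine ⟨√r, n₀, hδ0, (Real.sqrt_lt' one_pos).2 (by simpa using hr1), fun n hn => ?_⟩
  have h1 : a n ≤ (√r ^ n) ^ 2 := by
    rw [← pow_mul, mul_comm, pow_mul, Real.sq_sqrt hr0.le]
    refine (hpow n).trans ?_
    rw [← hrr, mul_pow, mul_assoc]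
    exact mul_le_of_le_one_right (by positivity) (hn₀ n hn)
  calc ENNReal.ofReal (a n) ^ (1 / 2 : ℝ)
      ≤ (ENNReal.ofReal (√r ^ n) ^ (2 : ℝ)) ^ (1 / 2 : ℝ) := by
        rw [ENNReal.rpow_ofNat, ← ENNReal.ofReal_pow (by positivity)]
        gcongr
    _ = ENNReal.ofReal (√r ^ n) := by
        rw [← ENNReal.rpow_mul]
        norm_num

/-- Iterates with `τ ≤ 1` stay in a bounded set of pairs with equal means. -/
lemma exists_abs_slack_iterate_le {X Y : Type*} [TopologicalSpace X] [MeasurableSpace X]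
    [BorelSpace X] [CompactSpace X] [SecondCountableTopology X] [TopologicalSpace Y]
    [MeasurableSpace Y] [BorelSpace Y] [CompactSpace Y] [SecondCountableTopology Y]
    (P : Measure X) (Q : Measure Y) [IsProbabilityMeasure P] [IsProbabilityMeasure Q]
    (c : C(X × Y, ℝ)) {ε τ : ℝ} (hε : 0 ≤ ε) (hτ0 : 0 ≤ τ) (hτ1 : τ ≤ 1)
    (u : C(X, ℝ) × C(Y, ℝ)) (hu : ∫ x, u.1 x ∂P = ∫ y, u.2 y ∂Q) :
    ∃ B : ℝ, 0 < B ∧ ∀ n, ∫ x, ((gradStep P Q c ε τ)^[n] u).1 x ∂P =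
        ∫ y, ((gradStep P Q c ε τ)^[n] u).2 y ∂Q ∧
      ∀ z : X × Y, |((gradStep P Q c ε τ)^[n] u).1 z.1 + ((gradStep P Q c ε τ)^[n] u).2 z.2 - c z|
        ≤ B := by
  set M := 2 * (‖c‖ + ‖u.1‖ + ‖u.2‖)
  set R := 2 * M + ‖c‖
  set H := (3 * ε + R) / 2 + |∫ x, u.1 x ∂P| with hH
  have hR : 0 ≤ R := by positivity
  have hc : ∀ z z', |c z - c z'| ≤ M := fun z z' => by
    have h1 := c.norm_coe_le_norm z
    have h2 := c.norm_coe_le_norm z'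
    exact (norm_sub_le (c z) (c z')).trans (by linarith [norm_nonneg u.1, norm_nonneg u.2])
  have hmem : ∀ n, (gradStep P Q c ε τ)^[n] u ∈
      boundedPairs P Q (fun _ _ => M) (fun _ _ => M) H R := fun n => by
    induction n with
    | zero =>
      refine ⟨fun x x' => ?_, fun y y' => ?_, hu, ?_, ?_⟩
      · have h1 := u.1.norm_coe_le_norm x
        have h2 := u.1.norm_coe_le_norm x'
        exact (norm_sub_le (u.1 x) (u.1 x')).trans (by linarith [norm_nonneg c, norm_nonneg u.2])
      · have h1 := u.2.norm_coe_le_norm y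
        have h2 := u.2.norm_coe_le_norm y'
        exact (norm_sub_le (u.2 y) (u.2 y')).trans (by linarith [norm_nonneg c, norm_nonneg u.1])
      · have := neg_abs_le (∫ x, u.1 x ∂P)
        simp only [Function.iterate_zero, id_eq]
        linarith
      · have := le_abs_self (∫ x, u.1 x ∂P)
        simp only [Function.iterate_zero, id_eq]
        linarith
    | succ n ih =>
      rw [Function.iterate_succ_apply']
      exact gradStep_mem_boundedPairs ih (fun _ _ => le_rfl) (fun _ _ => le_rfl)
        c.norm_coe_le_norm (fun _ _ _ => hc _ _) (fun _ _ _ => hc _ _) le_rfl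
        (le_add_of_nonneg_right (abs_nonneg _)) hε hτ0 hτ1
  refine ⟨2 * M + ‖c‖ + 2 * (H + R) + 1, by positivity, fun n => ⟨(hmem n).2.2.1, fun z => ?_⟩⟩
  exact (abs_slack_le (hmem n) (fun _ _ => le_rfl) (fun _ _ => le_rfl) c.norm_coe_le_norm hR
    z).trans (by linarith)

end Transport

end QOT

theorem theorem2p3 {d : ℕ} (P Q : Measure (QOT.Rd d))
    [IsProbabilityMeasure P] [IsProbabilityMeasure Q]
    (hP : IsCompact P.support) (hQ : IsCompact Q.support)
    (hQ_conn : IsConnected Q.support)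
    (hQ_conv : ∀ C : Set (QOT.Rd d), Convex ℝ C → Q (frontier C) = 0)
    (ε : ℝ) (hε : 0 < ε) :
    -- the regularized problem has a solution with potentials
    (∃ (π : Measure (QOT.Rd d × QOT.Rd d)) (f g : QOT.Rd d → ℝ),
      QOT.IsOptimalCoupling P Q ε π ∧ QOT.IsPotentials P Q ε π f g) ∧
    -- and gradient ascent converges linearly to them
    ∀ (πs : Measure (QOT.Rd d × QOT.Rd d)) (fs gs : QOT.Rd d → ℝ),
      QOT.IsOptimalCoupling P Q ε πs → QOT.IsPotentials P Q ε πs fs gs →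
    ∀ (f₀ g₀ : QOT.Rd d → ℝ),
      (∃ K : ℝ≥0, LipschitzOnWith K f₀ P.support) →
      (∃ K : ℝ≥0, LipschitzOnWith K g₀ Q.support) →
      ∫ x, f₀ x ∂P = ∫ y, g₀ y ∂Q →
    ∀ η : ℝ, 0 < η →
      (η < ε ∨ (η = ε ∧ πs.support ≠ P.support ×ˢ Q.support)) →
    ∃ (δ : ℝ) (n₀ : ℕ), 0 < δ ∧ δ < 1 ∧ ∀ n : ℕ, n₀ ≤ n →
      QOT.normL2Oplus P Q
        ((QOT.iterates P Q ε η (f₀, g₀) n).1 - fs)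
        ((QOT.iterates P Q ε η (f₀, g₀) n).2 - gs) ≤ ENNReal.ofReal (δ ^ n) := by
  have : CompactSpace P.support := isCompact_iff_compactSpace.1 hP
  have : CompactSpace Q.support := isCompact_iff_compactSpace.1 hQ
  have : ConnectedSpace Q.support := isConnected_iff_connectedSpace.1 hQ_conn
  obtain ⟨v, π, f, g, hext, hopt, hpot, hmean, hv₁, hv₂⟩ :=
    QOT.exists_isOptimalCoupling_isPotentials P Q hε
  refine ⟨⟨π, f, g, hopt, hpot⟩, ?_⟩
  rintro πs fs gs hopts hpots f₀ g₀ ⟨Kf, hKf⟩ ⟨Kg, hKg⟩ hmean₀ η hη hcase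
  obtain ⟨hfs, hgs⟩ := QOT.IsPotentials.ae_eq hε hv₁ hv₂ hext hopt.1 hopts.1 hpot hpots
  let u : C(P.support, ℝ) × C(Q.support, ℝ) :=
    (⟨P.support.domRestrict f₀, hKf.continuousOn.domRestrict⟩,
      ⟨Q.support.domRestrict g₀, hKg.continuousOn.domRestrict⟩)
  have hu : QOT.Extends u f₀ g₀ := ⟨fun _ => rfl, fun _ => rfl⟩
  have hτ : η / ε < 1 ∨ η / ε = 1 ∧
      ∃ z, v.1 z.1 + v.2 z.2 - QOT.quadCost P.support Q.support z < 0 := by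
    rcases hcase with h | ⟨h, hsupp⟩
    · exact .inl ((div_lt_one hε).2 h)
    · exact .inr ⟨by rw [h, div_self hε.ne'],
        QOT.exists_slack_neg hε hv₁ hv₂ hQ_conv hext hpots hfs hgs hsupp⟩
  have hτ1 : η / ε ≤ 1 := hτ.elim le_of_lt fun h => h.1.le
  obtain ⟨B, hB, hbound⟩ := QOT.exists_abs_slack_iterate_le (QOT.suppMeasure P)
    (QOT.suppMeasure Q) (QOT.quadCost P.support Q.support) hε.le (div_pos hη hε).le hτ1 u
    (by rw [← hu.integral_fst, ← hu.integral_snd, hmean₀])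
  obtain ⟨ρ, hρ0, hρ1, hcontr⟩ := QOT.exists_sqNorm_gradStep_sub_le (QOT.suppMeasure P)
    (QOT.suppMeasure Q) hε hv₁ hv₂ hmean hB (div_pos hη hε) hτ
  obtain ⟨δ, n₀, hδ0, hδ1, hδ⟩ := QOT.exists_rpow_half_le_pow (a := fun n => QOT.sqNorm
    (QOT.suppMeasure P) (QOT.suppMeasure Q)
    ⇑(((QOT.gradStep (QOT.suppMeasure P) (QOT.suppMeasure Q)
      (QOT.quadCost P.support Q.support) ε (η / ε))^[n] u).1 - v.1)
    ⇑(((QOT.gradStep (QOT.suppMeasure P) (QOT.suppMeasure Q)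
      (QOT.quadCost P.support Q.support) ε (η / ε))^[n] u).2 - v.2)) hρ0 hρ1 fun n => by
    have := hcontr _ (hbound n).1 (hbound n).2
    rwa [← Function.iterate_succ_apply' (QOT.gradStep _ _ _ _ _)] at this
  refine ⟨δ, n₀, hδ0, hδ1, fun n hn => ?_⟩
  rw [(hu.iterates hε.ne' η n).normL2Oplus_sub_eq hext hfs hgs]
  exact hδ n hn
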